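/- Let $X$ be a finite set of $n$ elements, let $\ell,z\ge 1$ be integers, and let $\mathcal M=\{M_i=(X_i,\mathcal I_i)\}_{i=1}^s$ be an $\ell$-matchoid on $X$: a family of matroids with $X_i\subseteq X$ such that every $e\in X$ lies in at most $\ell$ of the $X_i$. Call $S\subseteq X$ feasible if $S\cap X_i\in\mathcal I_i$ for all $i$, and assume that $\{e\}$ is feasible for every $e\in X$. Let $f:2^X\to\mathbb Z_{\ge 0}$ be an unweighted coverage function, i.e. $f(S)=|\bigcup_{e\in S}P(e)|$ for some subsets $P(e)$ of a finite universe; $f$ is available only through a value oracle, and the matroids through independence oracles. Write $f(x\mid S)=f(S\cup\{x\})-f(S)$. The elements of $X$ arrive one by one, in an arbitrary order, each together with the indices $i$ such that $e\in X_i$. For a set $T$ of elements, $\mathrm{RepSet}(T)$ is the output of $\mathrm{Guess}((\emptyset,\dots,\emptyset),T)$, where $\mathrm{Guess}((J_1,\dots,J_s),Y)$ returns $\emptyset$ if $Y=\emptyset$, and otherwise takes the element $e$ of $Y$ that arrived first and returns $\{e\}$, united, if $\sum_i|J_i|<(z-1)\ell$, with the outputs of $\mathrm{Guess}((J_1,\dots,J_i\cup\{e\},\dots,J_s),\,Y\setminus\mathrm{span}_{M_i}(J_i\cup\{e\}))$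 over all $i$ with $e\in X_i$. The algorithm StreamingCoverage keeps $z-1$ rooted trees with roots $\mathbf n_1,\dots,\mathbf n_{z-1}$. Each node $\mathbf n$ stores $z$ sets $R_1,\dots,R_z$ (initially empty), with union $\mathrm{AllReps}(\mathbf n)$, and has a parent element, which is a dummy element $\bot$ covering no points if $\mathbf n$ is a root, and an element stored at the parent node otherwise. When $e$ arrives: if $f(\{e\})\ge z$, stop and output $R=\{e\}$; if $f(\{e\})=0$, discard $e$; otherwise start at the node $\mathbf n=\mathbf n_{f(\{e\})}$ and search as follows. Let $p$ be the parent element of $\mathbf n$. If $f(e\mid p)=f(e\mid\{r,p\})$ for all $r\in\mathrm{AllReps}(\mathbf n)$, the search ends at $\mathbf n$. Otherwise take the first $r$ for which this fails; if some child $\mathbf n'$ of $\mathbf n$ with parent element $r$ satisfies $f(r\mid r')=f(r\mid e)=f(r\mid\{r',e\})$ for all $r'\in\mathrm{AllReps}(\mathbf n')$, continue from the first such $\mathbf n'$; if there is none, create a new child of $\mathbf n$ with parent element $r$, and the search ends there. At the node where the search ends, for $j=1,\dots,z$ replace $R_j$ by $\mathrm{RepSet}(R_j\cup\{e\})$, stopping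 as soon as the new $R_j$ contains $e$. After the last arrival, output the set $R$ of all elements stored in the trees. Put $$N_{1,z}=2^{(z-1)^2}z^{2z+1},\qquad N_{\ell,z}=2^{(z-1)^2}\,\ell^{\,z(z-1)\ell}\,z^{z+1}\quad(\ell>1).$$ There is an absolute constant $C$ such that in every case the following hold. 1. For every $T\subseteq X$, $\mathrm{RepSet}(T)$ is a joint $z$-representative set for $T$, $\mathcal M$ and every weight function $w:X\to\mathbb R$ that is strictly decreasing on $T$ in the order of arrival: $\mathrm{RepSet}(T)\subseteq T$, and for every feasible $B$ with $|B|\le z$ and every $b\in T\cap B$ there is $e\in\mathrm{RepSet}(T)$ with $w(e)\ge w(b)$ such that $(B\setminus\{b\})\cup\{e\}$ is feasible. 2. The output $R$ of StreamingCoverage is a kernel for finding a feasible set of value at least $z$: if some feasible $O\subseteq X$ has $f(O)\ge z$, then some feasible $S\subseteq R$ has $f(S)\ge z$ and $|S|\le z$. 3. $|R|\le C\,N_{\ell,z}$. 4. If $n\ge 2$ and $s\le n\ell$, the algorithm stores at most $C\,N_{\ell,z}\log_2 n$ bits at any time, where an element is written in $\lceil\log_2 n\rceil$ bits and an index of a matroid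 in $\lceil\log_2 s\rceil$ bits. 5. The algorithm makes at most $C\,N_{\ell,z}\,n$ value queries to $f$. -/

import Mathlib

/-! ### Matchoids, coverage functions, kernels, joint representative sets -/

/-- A family of matroids `M i` with ground sets `(M i).E ⊆ X` is an `ℓ`-matchoid if every element
lies in at most `ℓ` of the ground sets. -/
def IsMatchoid {X ι : Type} (ℓ : ℕ) (M : ι → Matroid X) : Prop :=
  ∀ e : X, {i | e ∈ (M i).E}.encard ≤ ℓ

/-- `S` is feasible if `S ∩ X_i` is independent in `M i` for all `i`. -/
def Feasible {X ι : Type} (M : ι → Matroid X) (S : Finset X) : Prop :=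
  ∀ i, (M i).Indep (↑S ∩ (M i).E)

/-- `f S` is the number of points of a finite universe `U` covered by the sets `P e`, `e ∈ S`. -/
def IsUnweightedCoverage {X : Type} (f : Finset X → ℕ) : Prop :=
  ∃ (U : Type) (_ : Fintype U) (_ : DecidableEq U) (P : X → Finset U),
    ∀ S : Finset X, f S = (S.biUnion P).card

/-- `R` is a kernel for finding a feasible set of value at least `z`: if there is such a set at
all, then there is one inside `R`; moreover one with at most `z` elements. -/
def IsKernel {X ι : Type} (M : ι → Matroid X) (f : Finset X → ℕ) (z : ℕ) (R : Finset X) : Prop :=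
  (∃ O : Finset X, Feasible M O ∧ z ≤ f O) →
    ∃ S : Finset X, S ⊆ R ∧ Feasible M S ∧ z ≤ f S ∧ S.card ≤ z

/-- `R` is a joint `k`-representative set for `(T, M, w)`. -/
def IsJointRepSet {X ι : Type} [DecidableEq X] (M : ι → Matroid X) (k : ℕ) (T : Finset X)
    (w : X → ℝ) (R : Finset X) : Prop :=
  R ⊆ T ∧ ∀ B : Finset X, Feasible M B → B.card ≤ k → ∀ b ∈ T ∩ B,
    ∃ e ∈ R, w b ≤ w e ∧ Feasible M (insert e (B.erase b))

/-! ### Programs with oracles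

A program has access to the objective only through `value` and to the matroids only through
`indep`. The instruction `hold m p` runs `p` while `m` further bits (the live variables of the
caller) are kept in memory. -/

inductive OProg (X ι : Type) : Type → Type 1
  | pure {β : Type} (b : β) : OProg X ι β
  | bind {β γ : Type} (p : OProg X ι γ) (k : γ → OProg X ι β) : OProg X ι β
  | value (S : Finset X) : OProg X ι ℕ
  | indep (i : ι) (S : Finset X) : OProg X ι Bool
  | hold {β : Type} (m : ℕ) (p : OProg X ι β) : OProg X ι β

namespace OProg

instance instMonad (X ι : Type) : Monad (OProg X ι) where
  pure := OProg.pure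
  bind := OProg.bind

variable {X ι : Type}

/-- The result of a program, for the value oracle `f` and the independence oracles `I`. -/
def eval (f : Finset X → ℕ) (I : ι → Finset X → Bool) : {β : Type} → OProg X ι β → β
  | _, .pure b => b
  | _, .bind p k => eval f I (k (eval f I p))
  | _, .value S => f S
  | _, .indep i S => I i S
  | _, .hold _ p => eval f I p

/-- The number of value queries that a program makes. -/
def valueQueries (f : Finset X → ℕ) (I : ι → Finset X → Bool) : {β : Type} → OProg X ι β → ℕ
  | _, .pure _ => 0
  | _, .bind p k => valueQueries f I p + valueQueries f I (k (eval f I p))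
  | _, .value _ => 1
  | _, .indep _ _ => 0
  | _, .hold _ p => valueQueries f I p

/-- The maximum, over the whole execution, of the number of bits in memory. -/
def peakBits (f : Finset X → ℕ) (I : ι → Finset X → Bool) : {β : Type} → OProg X ι β → ℕ
  | _, .pure _ => 0
  | _, .bind p k => max (peakBits f I p) (peakBits f I (k (eval f I p)))
  | _, .value _ => 0
  | _, .indep _ _ => 0
  | _, .hold m p => m + peakBits f I p

end OProg

/-! ### The streaming algorithm -/

namespace Coverage

/-- What the algorithm is given: the parameters `z` and `ℓ`, for each element `e` the list
`grounds e` of the indices `i` with `e ∈ X_i` (which arrives together with `e`), and the number of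
bits in which an element and an index are written; these two only serve to count memory. -/
structure Setup (X ι : Type) where
  z : ℕ
  ℓ : ℕ
  grounds : X → List ι
  elemBits : ℕ
  indexBits : ℕ

variable {X ι : Type} [DecidableEq X] [DecidableEq ι]

/-- For an independent set `T` of the `i`-th matroid, `Y` without the elements spanned by `T`:
those elements of `X_i` that lie in `T` or whose addition to `T` destroys independence. -/
def notSpanned (A : Setup X ι) (i : ι) (T : Finset X) : List X → OProg X ι (List X)
  | [] => pure []
  | y :: Y => do
    let keep ←
      if i ∈ A.grounds y then
        if y ∈ T then pure false else OProg.indep i (insert y T)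
      else pure true
    let Y' ← notSpanned A i T Y
    pure (if keep then y :: Y' else Y')

/-- The component `J_i` of a multi-dimensional set, given as the list of its pairs `(i, e)`. -/
def component (J : List (ι × X)) (i : ι) : Finset X :=
  ((J.filter fun q => q.1 = i).map Prod.snd).toFinset

/-- `Guess(J, Y)` with `d = (k - 1) ℓ - ‖J‖` levels of recursion left. The elements of `Y` are
listed by decreasing weight, that is, in order of arrival; the element of maximum weight is the
first one. The caller keeps `J` and `Y` in memory. -/
def guess (A : Setup X ι) : ℕ → List (ι × X) → List X → OProg X ι (Finset X)
  | _, _, [] => pure ∅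
  | 0, _, e :: _ => OProg.hold A.elemBits (pure {e})
  | d + 1, J, e :: Y =>
    (A.grounds e).foldlM (fun R i => do
      let Yi ← OProg.hold ((R.card + (Y.length + 1) + (J.length + 1)) * A.elemBits + A.indexBits)
        (notSpanned A i (insert e (component J i)) (e :: Y))
      let R' ← OProg.hold ((R.card + Yi.length + 1) * A.elemBits + A.indexBits)
        (guess A d ((i, e) :: J) Yi)
      OProg.hold ((R.card + R'.card) * A.elemBits) (pure (R ∪ R'))) {e}

/-- `RepSet(T)` with parameter `k = z`, for `T` listed in order of arrival. -/
def repSet (A : Setup X ι) (T : List X) : OProg X ι (Finset X) :=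
  guess A ((A.z - 1) * A.ℓ) [] T

/-- A list of sibling nodes. Every node has an associated element `parent` of the node above it,
the sets `R_1, …, R_z` (each listed in order of arrival), and its list of children. -/
inductive Forest (X : Type) : Type
  | nil : Forest X
  | cons (parent : X) (sets : List (List X)) (children siblings : Forest X) : Forest X

/-- A tree; its root has the dummy parent element, which covers no points. -/
structure Tree (X : Type) : Type where
  sets : List (List X)
  children : Forest X

/-- All elements stored in a forest. -/
def Forest.elems : Forest X → Finset X
  | .nil => ∅
  | .cons _ sets ch sib => sets.flatten.toFinset ∪ ch.elems ∪ sib.elems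

/-- All elements stored in a tree. -/
def Tree.elems (t : Tree X) : Finset X := t.sets.flatten.toFinset ∪ t.children.elems

/-- Bits of the sets at a node: every element is preceded by one bit, and one bit ends a set. -/
def setsBits (b : ℕ) (sets : List (List X)) : ℕ :=
  (sets.map fun R => R.length * (b + 1) + 1).sum

/-- Bits of a forest: one bit tells whether a node follows; a node is stored by its parent
element, its sets and its children. -/
def Forest.bits (b : ℕ) : Forest X → ℕ
  | .nil => 1
  | .cons _ sets ch sib => 1 + b + setsBits b sets + ch.bits b + sib.bits b

def Tree.bits (b : ℕ) (t : Tree X) : ℕ := setsBits b t.sets + t.children.bits b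

/-- `f(x | S) = f(S + x) - f(S)`, with two value queries. -/
def marginal (x : X) (S : Finset X) : OProg X ι ℤ := do
  let a ← OProg.value (insert x S)
  let b ← OProg.hold a.size (OProg.value S)
  pure ((a : ℤ) - b)

/-- The first `r` in the list with `f(e | p) ≠ f(e | {r, p})`; `none` for `p` is the dummy
element. -/
def firstClash (A : Setup X ι) (e : X) (p : Option X) : List X → OProg X ι (Option X)
  | [] => pure none
  | r :: rs => do
    let a ← OProg.hold A.elemBits (marginal e p.toFinset)
    let b ← OProg.hold (A.elemBits + 1 + a.natAbs.size) (marginal e (insert r p.toFinset))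
    if a ≠ b then pure (some r) else firstClash A e p rs

/-- Whether `f(r | r') = f(r | e) = f(r | {r', e})` for all `r'` in the list. -/
def sameTrace (A : Setup X ι) (e r : X) : List X → OProg X ι Bool
  | [] => pure true
  | r' :: rs => do
    let a ← OProg.hold (2 * A.elemBits) (marginal r {r'})
    let b ← OProg.hold (2 * A.elemBits + 1 + a.natAbs.size) (marginal r {e})
    let c ← OProg.hold (2 * A.elemBits + 2 + a.natAbs.size + b.natAbs.size) (marginal r {r', e})
    if a = b ∧ b = c then sameTrace A e r rs else pure false

/-- `ProcessElem(e, n)` on the sets `R_1, …, R_z` of `n`; returns the updated sets. -/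
def processElem (A : Setup X ι) (e : X) : List (List X) → OProg X ι (List (List X))
  | [] => pure []
  | R :: Rs => do
    let R' ← OProg.hold ((R.length + 1) * A.elemBits + A.z.size) (repSet A (R ++ [e]))
    let Rnew ← OProg.hold ((R.length + 1 + R'.card) * A.elemBits + A.z.size)
      (pure ((R ++ [e]).filter (· ∈ R')))
    if e ∈ R' then pure (Rnew :: Rs)
    else do
      let Rs' ← processElem A e Rs
      pure (Rnew :: Rs')

/-- `FindNode(e, n)` at a node `n` with parent element `p`, followed by `ProcessElem(e, n)` if the
search ends in `n`; otherwise the search goes on, by `descend r`, among the children of `n` that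
are associated with `r`. Returns the new sets and children of `n`. -/
def visit (A : Setup X ι) (e : X) (p : Option X) (sets : List (List X)) (ch : Forest X)
    (descend : X → OProg X ι (Forest X)) : OProg X ι (List (List X) × Forest X) := do
  match ← firstClash A e p sets.flatten with
  | none => do
    let sets' ← processElem A e sets
    pure (sets', ch)
  | some r => do
    let ch' ← OProg.hold (A.elemBits + 1) (descend r)
    pure (sets, ch')

/-- The part of `FindNode` that goes through the children associated with `r`, and opens a new
child if none of them fits. One bit is kept for every pointer that is followed. -/
def place (A : Setup X ι) (e : X) (r : X) : Forest X → OProg X ι (Forest X)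
  | .nil => do
    let sets ← processElem A e (List.replicate A.z [])
    pure (.cons r sets .nil .nil)
  | .cons p sets ch sib => do
    let fits ← if p = r then sameTrace A e r sets.flatten else pure false
    if fits then do
      let s ← visit A e (some p) sets ch (fun r' => place A e r' ch)
      pure (.cons p s.1 s.2 sib)
    else do
      let sib' ← OProg.hold 1 (place A e r sib)
      pure (.cons p sets ch sib')

/-- `FindNode(e, n)` followed by `ProcessElem`, for the root `n` of a tree. -/
def insertElem (A : Setup X ι) (e : X) (t : Tree X) : OProg X ι (Tree X) := do
  let s ← visit A e none t.sets t.children (fun r => place A e r t.children)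
  pure ⟨s.1, s.2⟩

/-- A tree that consists of its root only, with `R_1 = … = R_z = ∅`. -/
def emptyTree (z : ℕ) : Tree X := ⟨List.replicate z [], .nil⟩

/-- Bits of the trees with the numbers `1, …, z - 1`. -/
def treesBits (A : Setup X ι) (F : ℕ → Tree X) : ℕ :=
  ∑ j ∈ Finset.Icc 1 (A.z - 1), (F j).bits A.elemBits

/-- The main loop; `F j`, for `1 ≤ j ≤ z - 1`, is the tree of the elements `e` with `f(e) = j`.
Elements with `f(e) = 0` belong to no tree and are not stored. -/
def streamFrom (A : Setup X ι) : List X → (ℕ → Tree X) → OProg X ι (Finset X)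
  | [], F =>
    OProg.hold (treesBits A F) (pure ((Finset.Icc 1 (A.z - 1)).biUnion fun j => (F j).elems))
  | e :: es, F => do
    let v ← OProg.hold (treesBits A F + A.elemBits) (OProg.value {e})
    if A.z ≤ v then pure {e}
    else if v = 0 then streamFrom A es F
    else do
      let t ← OProg.hold (treesBits A F + A.elemBits + v.size) (insertElem A e (F v))
      streamFrom A es (Function.update F v t)

def streamingCoverage (A : Setup X ι) (stream : List X) : OProg X ι (Finset X) :=
  streamFrom A stream (fun _ => emptyTree A.z)

/-- `2^{(z-1)^2} z^{2z+1}` for `ℓ = 1` and `2^{(z-1)^2} ℓ^{z(z-1)ℓ} z^{z+1}` for `ℓ > 1`. -/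
def kernelBound (ℓ z : ℕ) : ℕ :=
  if ℓ = 1 then 2 ^ ((z - 1) ^ 2) * z ^ (2 * z + 1)
  else 2 ^ ((z - 1) ^ 2) * ℓ ^ (z * (z - 1) * ℓ) * z ^ (z + 1)

/-- The setup in which an element is written in `⌈log₂ |X|⌉` bits and an index of a matroid in
`⌈log₂ |ι|⌉` bits. -/
def stdSetup [Fintype X] [Fintype ι] (ℓ z : ℕ) (grounds : X → List ι) : Setup X ι where
  z := z
  ℓ := ℓ
  grounds := grounds
  elemBits := Nat.clog 2 (Fintype.card X)
  indexBits := Nat.clog 2 (Fintype.card ι)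

/-- The independence oracles of the matroids `M i`. -/
noncomputable def indepOracle (M : ι → Matroid X) : ι → Finset X → Bool :=
  fun i S => by classical exact decide ((M i).Indep ↑S)

end Coverage

/-! The proof rests on two exchange arguments.

The first is inside the matroids. Let b lie in a feasible B with |B| ≤ z. `exists_mem_guessSet`
follows one branch of `guess` along which every J_i is independent and spanned by (B - b) ∩ X_i. If
the first remaining element e can replace b, it is the answer, having the largest weight. Otherwise
some M_i is violated, so e is spanned by (B - b) ∩ X_i and may join J_i. What is then removed is
spanned as well, so b survives. Rank considerations give ‖J‖ ≤ (z - 1)ℓ (`SpannedBy.length_le`), so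
an exchange is found before the levels run out.

The second is a sunflower argument. The elements at a node all cover j points, have the same trace Q
on the set C covered by the parent element, and are disjoint outside C. If e reaches the node and
none of its z sets accepts e, then each set offers a feasible replacement for e. These z
replacements have disjoint petals outside C, and the rest of the solution covers fewer than z
points, so one petal is untouched; that replacement covers at least as much as e
(`NodeInv.substitutable`). Stored elements are never deleted, because `guess` on a prefix selects a
subset of what it selects on the whole list (`guessSet_subset_append`). So a solution can be moved
element by element into the final store (`isKernel_of_substitutable`).

For the size, a clash of e with a stored r means that P e and P r meet outside C, so P e ∩ P r
strictly contains Q. Traces therefore grow strictly on the way down, and the children of a node are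
told apart by pairs (r, Q') with Q ⊂ Q' ⊆ P r. With at most K elements per node this gives at most
K^m 2^(1+...+m) nodes for elements covering m points (`one_add_le_treeBound`, `ForestInv.nodes_le`,
`treeBound_eq`). Queries and memory are charged to the nodes and their stored elements. -/

/-! ### Evaluation rules for programs. -/

namespace OProg
variable {X ι β γ : Type} (f : Finset X → ℕ) (I : ι → Finset X → Bool)

@[simp] theorem eval_pure (b : β) : eval f I (Pure.pure b : OProg X ι β) = b := rfl
@[simp] theorem eval_bind (p : OProg X ι γ) (k : γ → OProg X ι β) :
    eval f I (p >>= k) = eval f I (k (eval f I p)) := rfl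
@[simp] theorem eval_value (S : Finset X) : eval f I (value S : OProg X ι ℕ) = f S := rfl
@[simp] theorem eval_indep (i : ι) (S : Finset X) : eval f I (indep i S) = I i S := rfl
@[simp] theorem eval_hold (m : ℕ) (p : OProg X ι β) : eval f I (hold m p) = eval f I p := rfl

@[simp] theorem valueQueries_pure (b : β) : valueQueries f I (Pure.pure b : OProg X ι β) = 0 := rfl
@[simp] theorem valueQueries_bind (p : OProg X ι γ) (k : γ → OProg X ι β) :
    valueQueries f I (p >>= k) = valueQueries f I p + valueQueries f I (k (eval f I p)) := rfl
@[simp] theorem valueQueries_value (S : Finset X) :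
    valueQueries f I (value S : OProg X ι ℕ) = 1 := rfl
@[simp] theorem valueQueries_indep (i : ι) (S : Finset X) :
    valueQueries f I (indep i S) = 0 := rfl
@[simp] theorem valueQueries_hold (m : ℕ) (p : OProg X ι β) :
    valueQueries f I (hold m p) = valueQueries f I p := rfl

@[simp] theorem peakBits_pure (b : β) : peakBits f I (Pure.pure b : OProg X ι β) = 0 := rfl
@[simp] theorem peakBits_bind (p : OProg X ι γ) (k : γ → OProg X ι β) :
    peakBits f I (p >>= k) = max (peakBits f I p) (peakBits f I (k (eval f I p))) := rfl
@[simp] theorem peakBits_value (S : Finset X) :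
    peakBits f I (value S : OProg X ι ℕ) = 0 := rfl
@[simp] theorem peakBits_indep (i : ι) (S : Finset X) : peakBits f I (indep i S) = 0 := rfl
@[simp] theorem peakBits_hold (m : ℕ) (p : OProg X ι β) :
    peakBits f I (hold m p) = m + peakBits f I p := rfl

end OProg

/-! ### `guess`: output, number of selected elements, memory. -/

namespace Coverage
open OProg hiding pure bind

variable {X ι : Type} [DecidableEq X] [DecidableEq ι]

/-- Whether `y` survives the removal of the elements spanned by `T` in the `i`-th matroid. -/
def kept (A : Setup X ι) (I : ι → Finset X → Bool) (i : ι) (T : Finset X) (y : X) : Bool :=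
  if i ∈ A.grounds y then if y ∈ T then false else I i (insert y T) else true

/-- The output of `guess`. -/
def guessSet (A : Setup X ι) (I : ι → Finset X → Bool) : ℕ → List (ι × X) → List X → Finset X
  | _, _, [] => ∅
  | 0, _, e :: _ => {e}
  | d + 1, J, e :: Y => insert e ((A.grounds e).toFinset.biUnion fun i =>
      guessSet A I d ((i, e) :: J) ((e :: Y).filter (kept A I i (insert e (component J i)))))

variable (A : Setup X ι) (f : Finset X → ℕ) (I : ι → Finset X → Bool)

@[simp] theorem eval_notSpanned (i : ι) (T : Finset X) (Y : List X) :
    eval f I (notSpanned A i T Y) = Y.filter (kept A I i T) := by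
  induction Y with
  | nil => rfl
  | cons y Y ih =>
    rw [notSpanned, List.filter_cons, kept]
    by_cases h : i ∈ A.grounds y <;> by_cases h' : y ∈ T <;> simp [h, h', ih]

theorem valueQueries_notSpanned (i : ι) (T : Finset X) (Y : List X) :
    valueQueries f I (notSpanned A i T Y) = 0 := by
  induction Y with
  | nil => rfl
  | cons y Y ih =>
    rw [notSpanned]
    by_cases h : i ∈ A.grounds y <;> by_cases h' : y ∈ T <;> simp [h, h', ih]

theorem peakBits_notSpanned (i : ι) (T : Finset X) (Y : List X) :
    peakBits f I (notSpanned A i T Y) = 0 := by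
  induction Y with
  | nil => rfl
  | cons y Y ih =>
    rw [notSpanned]
    by_cases h : i ∈ A.grounds y <;> by_cases h' : y ∈ T <;> simp [h, h', ih]

@[simp] theorem eval_guess (d : ℕ) (J : List (ι × X)) (Y : List X) :
    eval f I (guess A d J Y) = guessSet A I d J Y := by
  induction d generalizing J Y with
  | zero => cases Y <;> rfl
  | succ d ih =>
    cases Y with
    | nil => rfl
    | cons e Y =>
      rw [guess, guessSet]
      generalize A.grounds e = l
      rw [← Finset.singleton_union]
      generalize ({e} : Finset X) = R
      induction l generalizing R with
      | nil => simp
      | cons i l ihl =>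
        rw [List.foldlM_cons, eval_bind, ihl]
        simp [ih, Finset.union_assoc]

theorem valueQueries_guess (d : ℕ) (J : List (ι × X)) (Y : List X) :
    valueQueries f I (guess A d J Y) = 0 := by
  induction d generalizing J Y with
  | zero => cases Y <;> rfl
  | succ d ih =>
    cases Y with
    | nil => rfl
    | cons e Y =>
      rw [guess]
      generalize A.grounds e = l
      generalize ({e} : Finset X) = R
      induction l generalizing R with
      | nil => simp
      | cons i l ihl =>
        rw [List.foldlM_cons, valueQueries_bind, ihl]
        simp [ih, valueQueries_notSpanned]

/-- The number of elements that `guess` can select on `d` levels of recursion. -/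
def guessBound (ℓ : ℕ) : ℕ → ℕ
  | 0 => 1
  | d + 1 => 1 + ℓ * guessBound ℓ d

theorem card_guessSet_le {ℓ : ℕ} (hA : ∀ e, (A.grounds e).length ≤ ℓ) (d : ℕ)
    (J : List (ι × X)) (Y : List X) : (guessSet A I d J Y).card ≤ guessBound ℓ d := by
  induction d generalizing J Y with
  | zero => cases Y <;> simp [guessSet, guessBound]
  | succ d ih =>
    cases Y with
    | nil => simp [guessSet]
    | cons e Y =>
      rw [guessSet, guessBound, add_comm]
      refine (Finset.card_insert_le _ _).trans (Nat.succ_le_succ ?_)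
      refine (Finset.card_biUnion_le_card_mul _ _ _ fun i _ => ih _ _).trans ?_
      exact Nat.mul_le_mul_right _ ((List.toFinset_card_le _).trans (hA e))

theorem guessSet_subset (d : ℕ) (J : List (ι × X)) (Y : List X) :
    guessSet A I d J Y ⊆ Y.toFinset := by
  induction d generalizing J Y with
  | zero => cases Y <;> simp [guessSet]
  | succ d ih =>
    cases Y with
    | nil => simp [guessSet]
    | cons e Y =>
      rw [guessSet, Finset.insert_subset_iff, Finset.biUnion_subset]
      refine ⟨by simp, fun i _ => (ih _ _).trans fun x hx => ?_⟩
      rw [List.mem_toFinset] at hx ⊢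
      exact List.mem_of_mem_filter hx

/-- Both calls pick the same head, and filtering commutes with appending, so the branches
correspond. Late arrivals never displace a selected element; this is why the stored sets only grow.
-/
theorem guessSet_subset_append (d : ℕ) (J : List (ι × X)) (Y Z : List X) :
    guessSet A I d J Y ⊆ guessSet A I d J (Y ++ Z) := by
  induction d generalizing J Y Z with
  | zero => cases Y <;> simp [guessSet]
  | succ d ih =>
    cases Y with
    | nil => simp [guessSet]
    | cons e Y =>
      rw [List.cons_append, guessSet, guessSet]
      refine Finset.insert_subset_insert _ (Finset.biUnion_mono fun i _ => ?_)
      rw [← List.cons_append, List.filter_append]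
      exact ih _ _ _

/-- A bound on the memory that `guess` needs, on `d` levels of recursion, in terms of a bound `H`
on the memory held at one level. -/
theorem peakBits_guess_le {ℓ : ℕ} (hA : ∀ e, (A.grounds e).length ≤ ℓ) {L S D H : ℕ}
    (hH : (2 * S + L + D + 1) * A.elemBits + A.indexBits ≤ H)
    (hS : ∀ d ≤ D, guessBound ℓ d ≤ S) (d : ℕ) (J : List (ι × X)) (Y : List X)
    (hd : J.length + d ≤ D) (hY : Y.length ≤ L) :
    peakBits f I (guess A d J Y) ≤ (d + 1) * H := by
  induction d generalizing J Y with
  | zero =>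
    cases Y with
    | nil => simp [guess]
    | cons e Y =>
      simp only [guess, peakBits_hold, peakBits_pure]
      nlinarith [Nat.zero_le ((2 * S + L + D) * A.elemBits)]
  | succ d ih =>
    cases Y with
    | nil => simp [guess]
    | cons e Y =>
      rw [guess]
      -- The accumulator is measured together with all that the remaining indices may still
      -- contribute, so that the bound by `S` survives each round of the fold.
      have key : ∀ (l : List ι) (R : Finset X), R.card + l.length * guessBound ℓ d ≤ S →
          peakBits f I (l.foldlM (fun R i => do
            let Yi ← OProg.hold
              ((R.card + (Y.length + 1) + (J.length + 1)) * A.elemBits + A.indexBits)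
              (notSpanned A i (insert e (component J i)) (e :: Y))
            let R' ← OProg.hold ((R.card + Yi.length + 1) * A.elemBits + A.indexBits)
              (guess A d ((i, e) :: J) Yi)
            OProg.hold ((R.card + R'.card) * A.elemBits) (pure (R ∪ R'))) R) ≤
            (d + 1 + 1) * H := by
        intro l
        induction l with
        | nil => simp
        | cons i l ihl =>
          intro R hR
          rw [List.length_cons, Nat.succ_mul] at hR
          rw [List.foldlM_cons, peakBits_bind]
          set Yi := (e :: Y).filter (kept A I i (insert e (component J i))) with hYi
          have hYiL : Yi.length ≤ L := (List.length_filter_le _ _).trans hY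
          have hc := card_guessSet_le A I hA d ((i, e) :: J) Yi
          refine max_le ?_ ?_
          · simp only [peakBits_bind, peakBits_hold, peakBits_notSpanned, peakBits_pure, eval_hold,
              eval_notSpanned, eval_guess, add_zero]
            rw [← hYi]
            have h1 := ih ((i, e) :: J) Yi (by simp; omega) hYiL
            simp only [List.length_cons] at hY hd
            have hm : ∀ m, m ≤ 2 * S + L + D + 1 → m * A.elemBits + A.indexBits ≤ H :=
              fun m hm => (Nat.add_le_add_right (Nat.mul_le_mul_right _ hm) _).trans hH
            refine max_le ?_ (max_le ?_ ?_)
            · exact (hm _ (by omega)).trans (Nat.le_mul_of_pos_left _ (by omega))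
            -- One frame of size at most `H` on top of the d + 1 frames of the recursive call.
            · rw [Nat.succ_mul (d + 1), add_comm ((d + 1) * H)]
              exact Nat.add_le_add (hm _ (by omega)) h1
            · refine (Nat.le_add_right _ A.indexBits).trans ((hm _ ?_).trans
                (Nat.le_mul_of_pos_left _ (by omega)))
              omega
          · refine ihl _ ?_
            simp only [eval_bind, eval_hold, eval_notSpanned, eval_guess, eval_pure]
            have := Finset.card_union_le R (guessSet A I d ((i, e) :: J) Yi)
            rw [← hYi]
            omega
      refine key _ _ ?_
      have := hS (d + 1) (by omega)
      rw [guessBound] at this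
      have := Nat.mul_le_mul_right (guessBound ℓ d) (hA e)
      simp
      omega

end Coverage

/-! ### Matroid exchange: correctness of `guess` and `repSet`. -/

theorem Feasible.mono {X ι : Type} {M : ι → Matroid X} {S T : Finset X} (hT : Feasible M T)
    (h : S ⊆ T) : Feasible M S := fun i =>
  (hT i).subset (Set.inter_subset_inter_left _ (Finset.coe_subset.2 h))

namespace Coverage
open OProg hiding pure bind

variable {X ι : Type} [DecidableEq X] [DecidableEq ι]

theorem component_cons (i : ι) (e : X) (J : List (ι × X)) (i' : ι) :
    component ((i, e) :: J) i' =
      if i = i' then insert e (component J i') else component J i' := by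
  by_cases h : i = i' <;> simp [component, h]

theorem mem_closure_of_not_indep {N : Matroid X} {D : Finset X} {e : X}
    (hD : N.Indep (↑D ∩ N.E)) (h : ¬ N.Indep (↑(insert e D) ∩ N.E)) :
    e ∈ N.E ∧ e ∈ N.closure (↑D ∩ N.E) := by
  by_cases he : e ∈ N.E
  · refine ⟨he, ?_⟩
    rw [Finset.coe_insert, Set.insert_inter_of_mem he] at h
    by_contra hc
    exact h ((hD.notMem_closure_iff he).1 hc).1
  · rw [Finset.coe_insert, Set.insert_inter_of_notMem he] at h
    exact absurd hD h

/-- The components of `J` are independent and spanned by `D`, and no element is repeated. -/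
structure SpannedBy [Fintype ι] (M : ι → Matroid X) (D : Finset X) (J : List (ι × X)) : Prop where
  indep : ∀ i, (M i).Indep ↑(component J i)
  subset_closure : ∀ i, ↑(component J i) ⊆ (M i).closure (↑D ∩ (M i).E)
  length_eq : J.length = ∑ i, (component J i).card

theorem SpannedBy.nil [Fintype ι] (M : ι → Matroid X) (D : Finset X) : SpannedBy M D [] where
  indep i := by simp [component]
  subset_closure i := by simp [component]
  length_eq := by simp [component]

/-- Being outside the span of J_i keeps J_i independent and also makes `e` new there, so that the
length really grows; being in the span of `D` keeps the rank bound. -/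
theorem SpannedBy.cons [Fintype ι] {M : ι → Matroid X} {D : Finset X} {J : List (ι × X)}
    (h : SpannedBy M D J) {i : ι} {e : X} (he : e ∈ (M i).E)
    (heJ : e ∉ (M i).closure ↑(component J i)) (heD : e ∈ (M i).closure (↑D ∩ (M i).E)) :
    SpannedBy M D ((i, e) :: J) where
  indep i' := by
    rw [component_cons]
    split_ifs with hi
    · subst hi
      rw [Finset.coe_insert]
      exact (((h.indep i).notMem_closure_iff he).1 heJ).1
    · exact h.indep i'
  subset_closure i' := by
    rw [component_cons]
    split_ifs with hi
    · subst hi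
      rw [Finset.coe_insert]
      exact Set.insert_subset heD (h.subset_closure i)
    · exact h.subset_closure i'
  length_eq := by
    have hn : e ∉ component J i := by
      have := (((h.indep i).notMem_closure_iff he).1 heJ).2
      exact_mod_cast this
    have hc : ∀ i', (component ((i, e) :: J) i').card =
        (component J i').card + if i = i' then 1 else 0 := by
      intro i'
      rw [component_cons]
      split_ifs with hi
      · subst hi
        exact Finset.card_insert_of_notMem hn
      · rfl
    simp_rw [hc]
    rw [Finset.sum_add_distrib, ← h.length_eq]
    simp

/-- The size of a multi-dimensional set spanned by `D`. -/
theorem SpannedBy.length_le [Fintype ι] {M : ι → Matroid X} {ℓ : ℕ} (hM : IsMatchoid ℓ M)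
    {D : Finset X} {J : List (ι × X)} (hJ : SpannedBy M D J) : J.length ≤ D.card * ℓ := by
  rw [hJ.length_eq]
  classical
  have h1 : ∀ i, (component J i).card ≤ (D.filter fun x => x ∈ (M i).E).card := by
    intro i
    have h := (hJ.indep i).encard_le_eRk_of_subset (hJ.subset_closure i)
    rw [Matroid.eRk_closure_eq] at h
    have h2 := h.trans ((M i).eRk_le_encard _)
    have h3 : (↑D ∩ (M i).E : Set X) = ↑(D.filter fun x => x ∈ (M i).E) := by
      ext x; simp
    rw [h3, Set.encard_coe_eq_coe_finsetCard, Set.encard_coe_eq_coe_finsetCard] at h2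
    exact_mod_cast h2
  refine (Finset.sum_le_sum fun i _ => h1 i).trans ?_
  simp_rw [Finset.card_filter]
  -- Double counting of the incidences between `D` and the ground sets: each element of `D` lies in
  -- at most ℓ of them.
  rw [Finset.sum_comm, ← smul_eq_mul]
  refine Finset.sum_le_card_nsmul _ _ _ fun x _ => ?_
  rw [← Finset.card_filter]
  have h := hM x
  have h3 : {i | x ∈ (M i).E} = ↑(Finset.univ.filter fun i => x ∈ (M i).E) := by
    ext i; simp
  rw [h3, Set.encard_coe_eq_coe_finsetCard] at h
  exact_mod_cast h

theorem kept_iff {A : Setup X ι} {M : ι → Matroid X}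
    (hg : ∀ e i, i ∈ A.grounds e ↔ e ∈ (M i).E) {i : ι} {T : Finset X} (hT : (M i).Indep ↑T)
    (y : X) : kept A (indepOracle M) i T y ↔ (y ∈ (M i).E → y ∉ (M i).closure ↑T) := by
  rw [kept]
  by_cases hy : y ∈ (M i).E
  · rw [if_pos ((hg y i).2 hy), hT.notMem_closure_iff hy]
    by_cases hyT : y ∈ T <;> simp [hy, hyT, indepOracle]
  · rw [if_neg (mt (hg y i).1 hy)]
    simp [hy]

theorem head_mem_guessSet (A : Setup X ι) (I : ι → Finset X → Bool) (d : ℕ) (J : List (ι × X))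
    (e : X) (Y : List X) : e ∈ guessSet A I d J (e :: Y) := by
  cases d <;> simp [guessSet]

/-- Correctness of `guess`: if `J` is spanned by `B - b`, then `b` can be exchanged for a selected
element of no smaller weight. -/
theorem exists_mem_guessSet [Fintype ι] {A : Setup X ι} {M : ι → Matroid X} {ℓ : ℕ}
    (hM : IsMatchoid ℓ M) (hg : ∀ e i, i ∈ A.grounds e ↔ e ∈ (M i).E) {w : X → ℝ}
    {B : Finset X} (hB : Feasible M B) {b : X} (hb : b ∈ B) (d : ℕ) (J : List (ι × X))
    (Y : List X) (hJ : SpannedBy M (B.erase b) J)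
    (hYJ : ∀ y ∈ Y, ∀ i, y ∈ (M i).E → y ∉ (M i).closure ↑(component J i))
    (hbY : b ∈ Y) (hw : Y.Pairwise fun a c => w c ≤ w a)
    (hd : (B.erase b).card * ℓ ≤ J.length + d) :
    ∃ e ∈ guessSet A (indepOracle M) d J Y, w b ≤ w e ∧ Feasible M (insert e (B.erase b)) := by
  induction d generalizing J Y with
  | zero | succ d ih =>
    cases Y with
    | nil => simp at hbY
    | cons e Y =>
      by_cases hf : Feasible M (insert e (B.erase b))
      · refine ⟨e, head_mem_guessSet _ _ _ _ _ _, ?_, hf⟩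
        rcases List.mem_cons.1 hbY with rfl | h
        · exact le_rfl
        · exact (List.pairwise_cons.1 hw).1 b h
      obtain ⟨i, hi⟩ := not_forall.1 hf
      obtain ⟨he, hecl⟩ := mem_closure_of_not_indep (hB.mono (B.erase_subset b) i) hi
      have hJ' := hJ.cons he (hYJ e (by simp) i he) hecl
      have hlen := hJ'.length_le hM
      rw [List.length_cons] at hlen
      -- With no level left, the longer J would exceed the rank bound, a contradiction that `omega`
      -- sees. In the inductive step there is no contradiction, and the second alternative recurses.
      first
      | omega
      | have hcomp : component ((i, e) :: J) i = insert e (component J i) := by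
          simp [component_cons]
        have hT : (M i).Indep ↑(insert e (component J i)) := hcomp ▸ hJ'.indep i
        have hTcl := hcomp ▸ hJ'.subset_closure i
        have hmem : ∀ y, y ∈ (e :: Y).filter (kept A (indepOracle M) i
            (insert e (component J i))) ↔ y ∈ e :: Y ∧ (y ∈ (M i).E →
              y ∉ (M i).closure ↑(insert e (component J i))) := by
          intro y
          rw [List.mem_filter, kept_iff hg hT]
        obtain ⟨x, hx, hxw, hxf⟩ := ih ((i, e) :: J) _ hJ' (fun y hy i' hy' => by
            rw [component_cons]
            split_ifs with hii
            · subst hii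
              exact ((hmem y).1 hy).2 hy'
            · exact hYJ y ((hmem y).1 hy).1 i' hy')
          -- `b` is not removed: being spanned by J_i + e, it would be spanned by (B - b) ∩ X_i,
          -- against the independence of B ∩ X_i.
          ((hmem b).2 ⟨hbY, fun hbE hbT => by
            have h1 := hB i
            rw [← Finset.insert_erase hb, Finset.coe_insert, Set.insert_inter_of_mem hbE] at h1
            have h2 := ((hB.mono (B.erase_subset b) i).notMem_closure_iff hbE).2
              ⟨h1, by simp⟩
            exact h2 ((M i).closure_subset_closure_of_subset_closure hTcl hbT)⟩)
          (hw.filter _) (by rw [List.length_cons]; omega)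
        refine ⟨x, ?_, hxw, hxf⟩
        rw [guessSet]
        exact Finset.mem_insert_of_mem (Finset.mem_biUnion.2
          ⟨i, List.mem_toFinset.2 ((hg e i).2 he), hx⟩)

theorem exists_mem_repSet [Fintype ι] {A : Setup X ι} {M : ι → Matroid X}
    (hM : IsMatchoid A.ℓ M) (hg : ∀ e i, i ∈ A.grounds e ↔ e ∈ (M i).E)
    (hsingle : ∀ e : X, Feasible M {e}) {w : X → ℝ} {T : List X}
    (hw : T.Pairwise fun a c => w c ≤ w a) {B : Finset X} (hB : Feasible M B)
    (hcard : B.card ≤ A.z) {b : X} (hb : b ∈ B) (hbT : b ∈ T) :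
    ∃ e ∈ guessSet A (indepOracle M) ((A.z - 1) * A.ℓ) [] T,
      w b ≤ w e ∧ Feasible M (insert e (B.erase b)) := by
  refine exists_mem_guessSet hM hg hB hb _ _ _ (SpannedBy.nil M _) (fun y _ i hy => ?_) hbT hw ?_
  -- Singletons are feasible, so no element is a loop and none is spanned by the empty J.
  · rw [show (↑(component ([] : List (ι × X)) i) : Set X) = ∅ by simp [component],
      (M i).empty_indep.notMem_closure_iff hy]
    refine ⟨?_, by simp⟩
    have := hsingle y i
    rw [Finset.coe_singleton, Set.inter_eq_left.2 (by simpa using hy)] at this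
    simpa using this
  · rw [Finset.card_erase_of_mem hb, List.length_nil, zero_add]
    exact Nat.mul_le_mul_right _ (by omega)

theorem isJointRepSet_repSet [Fintype ι] {A : Setup X ι} {M : ι → Matroid X}
    (hM : IsMatchoid A.ℓ M) (hg : ∀ e i, i ∈ A.grounds e ↔ e ∈ (M i).E)
    (hsingle : ∀ e : X, Feasible M {e}) (f : Finset X → ℕ) {w : X → ℝ} {T : List X}
    (hw : T.Pairwise fun a c => w c < w a) :
    IsJointRepSet M A.z T.toFinset w ((repSet A T).eval f (indepOracle M)) := by
  rw [repSet, eval_guess]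
  refine ⟨guessSet_subset _ _ _ _ _, fun B hB hcard b hb => ?_⟩
  rw [Finset.mem_inter, List.mem_toFinset] at hb
  exact exists_mem_repSet hM hg hsingle (hw.imp le_of_lt) hB hcard hb.2 hb.1

end Coverage

/-! ### The sets at a node: stability, sunflowers, substitution. -/

namespace Coverage
open OProg hiding pure bind

section Substitution

variable {X ι : Type} [DecidableEq X]

/-- In a feasible set of value less than `z` after the removal of `e`, the element `e` can be
exchanged for an element of `R` without loss of value. -/
def Substitutable (M : ι → Matroid X) (f : Finset X → ℕ) (z : ℕ) (e : X) (R : Finset X) : Prop :=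
  ∀ B : Finset X, Feasible M B → B.card ≤ z → e ∈ B → f (B.erase e) < z →
    ∃ e' ∈ R, Feasible M (insert e' (B.erase e)) ∧ f B ≤ f (insert e' (B.erase e))

theorem Substitutable.mono {M : ι → Matroid X} {f : Finset X → ℕ} {z : ℕ} {e : X}
    {R R' : Finset X} (h : Substitutable M f z e R) (hR : R ⊆ R') : Substitutable M f z e R' :=
  fun B h1 h2 h3 h4 => let ⟨e', he', h'⟩ := h B h1 h2 h3 h4; ⟨e', hR he', h'⟩

theorem substitutable_of_mem (M : ι → Matroid X) (f : Finset X → ℕ) (z : ℕ) {e : X}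
    {R : Finset X} (h : e ∈ R) : Substitutable M f z e R :=
  fun B h1 _ h3 _ => ⟨e, h, by rwa [Finset.insert_erase h3], by rw [Finset.insert_erase h3]⟩

end Substitution

variable {X ι : Type} [DecidableEq X] [DecidableEq ι]

/-- The output of `repSet`. -/
def repFinset (A : Setup X ι) (I : ι → Finset X → Bool) (T : List X) : Finset X :=
  guessSet A I ((A.z - 1) * A.ℓ) [] T

/-- `repSet` selects all elements of `R`. -/
def Stable (A : Setup X ι) (I : ι → Finset X → Bool) (R : List X) : Prop :=
  ∀ x ∈ R, x ∈ repFinset A I R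

/-- The effect of `processElem` on stable sets: `e` is added to the first set in which it is
selected. -/
def insertSets (A : Setup X ι) (I : ι → Finset X → Bool) (e : X) : List (List X) → List (List X)
  | [] => []
  | R :: Rs => if e ∈ repFinset A I (R ++ [e]) then (R ++ [e]) :: Rs else R :: insertSets A I e Rs

section Sets

variable {A : Setup X ι} {I : ι → Finset X → Bool} {e : X}

@[simp] theorem eval_repSet (A : Setup X ι) (f : Finset X → ℕ) (I : ι → Finset X → Bool)
    (T : List X) : eval f I (repSet A T) = repFinset A I T := by
  rw [repSet, eval_guess, repFinset]

theorem Stable.nil : Stable A I [] := by simp [Stable]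

theorem Stable.mem_append {R : List X} (h : Stable A I R) {x : X} (hx : x ∈ R) :
    x ∈ repFinset A I (R ++ [e]) := guessSet_subset_append _ _ _ _ _ _ (h x hx)

theorem Stable.filter_append {R : List X} (h : Stable A I R) :
    (R ++ [e]).filter (· ∈ repFinset A I (R ++ [e])) =
      if e ∈ repFinset A I (R ++ [e]) then R ++ [e] else R := by
  rw [List.filter_append, List.filter_eq_self.2 fun x hx => by simpa using h.mem_append hx]
  split_ifs with he <;> simp [he]

theorem Stable.append {R : List X} (h : Stable A I R) (he : e ∈ repFinset A I (R ++ [e])) :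
    Stable A I (R ++ [e]) := by
  intro x hx
  rcases List.mem_append.1 hx with hx | hx
  · exact h.mem_append hx
  · rwa [List.mem_singleton.1 hx]

theorem eval_processElem (f : Finset X → ℕ) {sets : List (List X)}
    (h : ∀ R ∈ sets, Stable A I R) :
    eval f I (processElem A e sets) = insertSets A I e sets := by
  induction sets with
  | nil => rfl
  | cons R Rs ih =>
    rw [processElem, insertSets]
    simp only [eval_bind, eval_hold, eval_repSet, eval_pure, (h R (by simp)).filter_append]
    split_ifs <;> simp [ih fun R hR => h R (by simp [hR])]

theorem length_insertSets (sets : List (List X)) :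
    (insertSets A I e sets).length = sets.length := by
  induction sets with
  | nil => rfl
  | cons R Rs ih => rw [insertSets]; split_ifs <;> simp [ih]

theorem stable_insertSets {sets : List (List X)} (h : ∀ R ∈ sets, Stable A I R) :
    ∀ R ∈ insertSets A I e sets, Stable A I R := by
  induction sets with
  | nil => simp [insertSets]
  | cons R Rs ih =>
    rw [List.forall_mem_cons] at h
    rw [insertSets]
    split_ifs with he
    · exact List.forall_mem_cons.2 ⟨h.1.append he, h.2⟩
    · exact List.forall_mem_cons.2 ⟨h.1, ih h.2⟩

/-- Either exactly one set takes `e`, or every set rejects it. The permutation form transfers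
membership and absence of duplicates at once. -/
theorem insertSets_cases (sets : List (List X)) :
    (insertSets A I e sets).flatten.Perm (e :: sets.flatten) ∨
      insertSets A I e sets = sets ∧ ∀ R ∈ sets, e ∉ repFinset A I (R ++ [e]) := by
  induction sets with
  | nil => simp [insertSets]
  | cons R Rs ih =>
    rw [insertSets]
    split_ifs with he
    · left
      simp
    · rcases ih with ih | ⟨ih, h⟩
      · left
        rw [List.flatten_cons, List.flatten_cons]
        exact (ih.append_left R).trans List.perm_middle
      · exact Or.inr ⟨by rw [ih], List.forall_mem_cons.2 ⟨he, h⟩⟩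

theorem mem_flatten_insertSets {sets : List (List X)} {x : X}
    (hx : x ∈ (insertSets A I e sets).flatten) : x = e ∨ x ∈ sets.flatten := by
  rcases insertSets_cases (A := A) (I := I) (e := e) sets with h | ⟨h, -⟩
  · simpa using h.mem_iff.1 hx
  · exact Or.inr (h ▸ hx)

theorem flatten_subset_insertSets (sets : List (List X)) {x : X} (hx : x ∈ sets.flatten) :
    x ∈ (insertSets A I e sets).flatten := by
  rcases insertSets_cases (A := A) (I := I) (e := e) sets with h | ⟨h, -⟩
  · exact h.mem_iff.2 (List.mem_cons_of_mem _ hx)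
  · rwa [h]

theorem insertSets_replicate_nil {z : ℕ} (hz : 1 ≤ z) :
    (insertSets A I e (List.replicate z [])).flatten = [e] := by
  obtain ⟨z, rfl⟩ := Nat.exists_eq_add_of_le' hz
  rw [List.replicate_succ, insertSets, if_pos (show e ∈ repFinset A I ([] ++ [e]) from head_mem_guessSet _ _ _ _ _ _)]
  simp

end Sets

section Nodes

variable {U : Type} [DecidableEq U] (A : Setup X ι) (I : ι → Finset X → Bool) (P : X → Finset U)

/-- The sets at a node whose parent element covers `C`: all elements cover `j` points, have the
trace `Q` on `C`, and are disjoint outside of `C`. -/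
structure NodeInv (j : ℕ) (C Q : Finset U) (sets : List (List X)) : Prop where
  length_eq : sets.length = A.z
  stable : ∀ R ∈ sets, Stable A I R
  nodup : sets.flatten.Nodup
  card_eq : ∀ r ∈ sets.flatten, (P r).card = j
  trace_eq : ∀ r ∈ sets.flatten, P r ∩ C = Q
  sunflower : ∀ r ∈ sets.flatten, ∀ r' ∈ sets.flatten, r ≠ r' → Disjoint (P r \ C) (P r')

/-- What is required of an element `e` whose search has reached such a node. -/
structure Reaches (j : ℕ) (C Q : Finset U) (sets : List (List X)) (e : X) : Prop where
  notMem : e ∉ sets.flatten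
  card_eq : (P e).card = j
  trace_eq : P e ∩ C = Q

variable {A I P} {j : ℕ} {C Q : Finset U} {sets : List (List X)} {e : X}

theorem nodeInv_replicate (j : ℕ) (C Q : Finset U) :
    NodeInv A I P j C Q (List.replicate A.z []) where
  length_eq := by simp
  stable R hR := by rw [List.eq_of_mem_replicate hR]; exact Stable.nil
  nodup := by simp
  card_eq := by simp
  trace_eq := by simp
  sunflower := by simp

theorem disjoint_sdiff_swap {α : Type} [DecidableEq α] {s t c : Finset α}
    (h : Disjoint (s \ c) t) : Disjoint (t \ c) s := by
  rw [Finset.disjoint_left] at h ⊢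
  intro x hx hs
  rw [Finset.mem_sdiff] at hx
  exact h (Finset.mem_sdiff.2 ⟨hs, hx.2⟩) hx.1

theorem NodeInv.insertSets (h : NodeInv A I P j C Q sets) (he : Reaches P j C Q sets e)
    (hd : ∀ r ∈ sets.flatten, Disjoint (P e \ C) (P r)) :
    NodeInv A I P j C Q (insertSets A I e sets) where
  length_eq := (length_insertSets sets).trans h.length_eq
  stable := stable_insertSets h.stable
  nodup := by
    rcases insertSets_cases (A := A) (I := I) (e := e) sets with h' | ⟨h', -⟩
    · exact h'.nodup_iff.2 (List.nodup_cons.2 ⟨he.notMem, h.nodup⟩)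
    · rw [h']; exact h.nodup
  card_eq r hr := by
    rcases mem_flatten_insertSets hr with rfl | hr
    exacts [he.card_eq, h.card_eq r hr]
  trace_eq r hr := by
    rcases mem_flatten_insertSets hr with rfl | hr
    exacts [he.trace_eq, h.trace_eq r hr]
  sunflower r hr r' hr' hne := by
    rcases mem_flatten_insertSets hr with h1 | h1 <;>
      rcases mem_flatten_insertSets hr' with h2 | h2
    · exact absurd (h1.trans h2.symm) hne
    · exact h1 ▸ hd r' h2
    · exact h2 ▸ disjoint_sdiff_swap (hd r h1)
    · exact h.sunflower r h1 r' h2 hne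

/-- Of `z` sets that are disjoint outside of `C`, one is disjoint from `W` outside of `C` if `W`
has less than `z` points. -/
theorem exists_disjoint_petal {z : ℕ} {C W : Finset U} (hW : W.card < z) (g : Fin z → Finset U)
    (hg : Pairwise fun i k => Disjoint (g i \ C) (g k)) : ∃ i, Disjoint (g i \ C) W := by
  by_contra! hc
  simp_rw [Finset.not_disjoint_iff] at hc
  -- If every petal met `W`, the chosen points would be distinct, and `W` would have at least `z`
  -- points.
  choose x hx hxW using hc
  have hinj : Function.Injective x := by
    intro i k hik
    by_contra hne
    exact Finset.disjoint_left.1 (hg hne) (hx i) (hik ▸ (Finset.mem_sdiff.1 (hx k)).1)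
  have := Finset.card_le_card_of_injOn (s := Finset.univ) (t := W) x (fun i _ => hxW i)
    hinj.injOn
  simp at this
  omega

/-- Outside `C`, both sets have |s| - |Q| points. Those of `t` are all new over Q ∪ W, while those
of `s` contribute at most that many. -/
theorem card_union_le_of_petal {C Q W s t : Finset U} (hcard : s.card = t.card)
    (hs : s ∩ C = Q) (ht : t ∩ C = Q) (hd : Disjoint (t \ C) W) :
    (s ∪ W).card ≤ (t ∪ W).card := by
  have h1 : s ∪ W ⊆ (Q ∪ W) ∪ (s \ C) := by
    intro x hx
    by_cases hxC : x ∈ C <;> simp [← hs, hxC] at hx ⊢ <;> tauto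
  have h2 : (Q ∪ W) ∪ (t \ C) ⊆ t ∪ W := by
    intro x hx
    rw [← ht] at hx
    simp only [Finset.mem_union, Finset.mem_inter, Finset.mem_sdiff] at hx ⊢
    tauto
  have h3 : Disjoint (Q ∪ W) (t \ C) := by
    refine Finset.disjoint_union_left.2 ⟨?_, hd.symm⟩
    rw [← ht]
    exact Finset.disjoint_of_subset_left Finset.inter_subset_right Finset.disjoint_sdiff
  have h4 := Finset.card_sdiff_add_card_inter s C
  have h5 := Finset.card_sdiff_add_card_inter t C
  rw [hs] at h4
  rw [ht] at h5
  have h6 := Finset.card_le_card h2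
  rw [Finset.card_union_of_disjoint h3] at h6
  have h7 := (Finset.card_le_card h1).trans (Finset.card_union_le _ _)
  omega

/-- A rejected `e` has one feasible replacement in each of the `z` sets at the node; the sunflower
property guarantees that one of them loses no value. -/
theorem NodeInv.substitutable [Fintype ι] {M : ι → Matroid X} (hM : IsMatchoid A.ℓ M)
    (hg : ∀ e i, i ∈ A.grounds e ↔ e ∈ (M i).E) (hsingle : ∀ e : X, Feasible M {e})
    {f : Finset X → ℕ} (hf : ∀ S, f S = (S.biUnion P).card)
    (h : NodeInv A (indepOracle M) P j C Q sets) (he : Reaches P j C Q sets e) :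
    Substitutable M f A.z e (Coverage.insertSets A (indepOracle M) e sets).flatten.toFinset := by
  rcases insertSets_cases (A := A) (I := indepOracle M) (e := e) sets with h' | ⟨h', hrep⟩
  · refine substitutable_of_mem _ _ _ ?_
    rw [List.mem_toFinset, h'.mem_iff]
    simp
  rw [h']
  intro B hB hcard heB hlt
  have hex : ∀ R ∈ sets, ∃ x ∈ R, Feasible M (insert x (B.erase e)) := by
    intro R hR
    -- Only the feasibility of the exchange matters here, so a constant weight suffices. The
    -- replacement is not `e`, which was not selected, so it lies in `R`.
    obtain ⟨x, hx, -, hxf⟩ := exists_mem_repSet hM hg hsingle (w := fun _ => 0) (T := R ++ [e])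
      (List.pairwise_of_forall fun _ _ => le_rfl) hB hcard heB (by simp)
    refine ⟨x, ?_, hxf⟩
    have := guessSet_subset _ _ _ _ _ hx
    rw [List.mem_toFinset, List.mem_append, List.mem_singleton] at this
    refine this.resolve_right ?_
    rintro rfl
    exact hrep R hR hx
  have hlen : ∀ i : Fin A.z, (i : ℕ) < sets.length := fun i => h.length_eq.symm ▸ i.2
  have hex' : ∀ i : Fin A.z, ∃ x ∈ sets[i]'(hlen i),
      Feasible M (insert x (B.erase e)) := fun i => hex _ (List.getElem_mem _)
  choose x hx hxf using hex'
  have hmem : ∀ i, x i ∈ sets.flatten := fun i =>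
    List.mem_flatten.2 ⟨_, List.getElem_mem _, hx i⟩
  -- The `z` sets share no element, so their replacements are different and have disjoint petals.
  have hne : ∀ i k, i ≠ k → x i ≠ x k := by
    have hp := (List.nodup_flatten.1 h.nodup).2
    rw [List.pairwise_iff_getElem] at hp
    have hlt : ∀ i k, i < k → x i ≠ x k := fun i k hik heq =>
      hp i k (hlen i) (hlen k) hik (hx i) (heq ▸ hx k)
    intro i k hik
    rcases lt_or_gt_of_ne hik with h1 | h1
    · exact hlt i k h1
    · exact (hlt k i h1).symm
  rw [hf] at hlt
  obtain ⟨i, hi⟩ := exists_disjoint_petal (C := C) hlt (fun i => P (x i))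
    fun i k hik => h.sunflower _ (hmem i) _ (hmem k) (hne i k hik)
  refine ⟨x i, List.mem_toFinset.2 (hmem i), hxf i, ?_⟩
  rw [← Finset.insert_erase heB, Finset.erase_insert_eq_erase, hf, hf, Finset.biUnion_insert,
    Finset.biUnion_insert]
  have herase : (B.erase e).erase e = B.erase e := by simp
  rw [herase]
  exact card_union_le_of_petal (he.card_eq.trans (h.card_eq _ (hmem i)).symm) he.trace_eq
    (h.trace_eq _ (hmem i)) hi

end Nodes

end Coverage

/-! ### The trees: value comparisons, search, preservation of the invariants. -/

namespace Coverage
open OProg hiding pure bind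

/-- The points covered by an optional element; the dummy element covers nothing. -/
def cover {X U : Type} [DecidableEq U] (P : X → Finset U) (p : Option X) : Finset U :=
  p.toFinset.biUnion P

@[simp] theorem cover_none {X U : Type} [DecidableEq U] (P : X → Finset U) :
    cover P none = ∅ := rfl

@[simp] theorem cover_some {X U : Type} [DecidableEq U] (P : X → Finset U) (p : X) :
    cover P (some p) = P p := by simp [cover]

theorem card_sdiff_eq_iff_disjoint {U : Type} [DecidableEq U] (s t c : Finset U) :
    (s \ c).card = (s \ (t ∪ c)).card ↔ Disjoint (s \ c) t := by
  have h : s \ (t ∪ c) = (s \ c) \ t := by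
    rw [Finset.union_comm, sdiff_sdiff_left, Finset.sup_eq_union]
  rw [h, ← Finset.sdiff_eq_self_iff_disjoint]
  exact ⟨fun h => Finset.eq_of_subset_of_card_le Finset.sdiff_subset h.le, fun h => by rw [h]⟩

/-- The union leaves a subset of what either set leaves of `s`. If all three cardinalities agree, so
do the remainders, hence also their complements in `s`. This is the test made by `sameTrace`. -/
theorem card_sdiff_eq_iff_inter_eq {U : Type} [DecidableEq U] (s t c : Finset U) :
    ((s \ t).card = (s \ c).card ∧ (s \ c).card = (s \ (t ∪ c)).card) ↔ s ∩ t = s ∩ c := by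
  constructor
  · rintro ⟨h1, h2⟩
    have h3 : s \ (t ∪ c) = s \ c := Finset.eq_of_subset_of_card_le
      (Finset.sdiff_subset_sdiff le_rfl Finset.subset_union_right) h2.le
    have h4 : s \ (t ∪ c) = s \ t := Finset.eq_of_subset_of_card_le
      (Finset.sdiff_subset_sdiff le_rfl Finset.subset_union_left) (h1.trans h2).le
    rw [← Finset.sdiff_sdiff_self_left, ← h4, h3, Finset.sdiff_sdiff_self_left]
  · intro h
    have h1 : s \ t = s \ c := by rw [← Finset.sdiff_inter_self_left, h,
      Finset.sdiff_inter_self_left]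
    rw [Finset.sdiff_union_distrib, h1, Finset.inter_self]
    exact ⟨rfl, rfl⟩

theorem eval_marginal {X ι U : Type} [DecidableEq X] [DecidableEq U] {P : X → Finset U}
    {f : Finset X → ℕ} {I : ι → Finset X → Bool} (hf : ∀ S, f S = (S.biUnion P).card)
    (x : X) (S : Finset X) :
    eval f I (marginal x S) = ((P x \ S.biUnion P).card : ℤ) := by
  simp only [marginal, eval_bind, eval_value, eval_hold, eval_pure, hf, Finset.biUnion_insert]
  rw [← Finset.card_sdiff_add_card]
  push_cast
  ring

variable {X ι U : Type} [DecidableEq X] [DecidableEq U] {P : X → Finset U}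
  {f : Finset X → ℕ} {A : Setup X ι} {I : ι → Finset X → Bool}

theorem firstClash_cons (e : X) (p : Option X) (r : X) (rs : List X)
    (hf : ∀ S, f S = (S.biUnion P).card) :
    eval f I (firstClash A e p (r :: rs)) =
      if Disjoint (P e \ cover P p) (P r) then eval f I (firstClash A e p rs) else some r := by
  rw [firstClash]
  simp only [eval_bind, eval_hold, eval_marginal hf, Finset.biUnion_insert]
  have hiff := card_sdiff_eq_iff_disjoint (P e) (P r) (cover P p)
  rw [← cover]
  split_ifs with h1 h2 h2
  · exact absurd (by exact_mod_cast hiff.2 h2) h1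
  · rfl
  · rfl
  · exact absurd (hiff.1 (by exact_mod_cast not_not.1 h1)) h2

theorem firstClash_eq_none (hf : ∀ S, f S = (S.biUnion P).card) {e : X} {p : Option X}
    {rs : List X} (h : eval f I (firstClash A e p rs) = none) :
    ∀ r ∈ rs, Disjoint (P e \ cover P p) (P r) := by
  induction rs with
  | nil => simp
  | cons r rs ih =>
    rw [firstClash_cons _ _ _ _ hf] at h
    split_ifs at h with hd
    exact List.forall_mem_cons.2 ⟨hd, ih h⟩

theorem firstClash_eq_some (hf : ∀ S, f S = (S.biUnion P).card) {e r : X} {p : Option X}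
    {rs : List X} (h : eval f I (firstClash A e p rs) = some r) :
    r ∈ rs ∧ ¬ Disjoint (P e \ cover P p) (P r) := by
  induction rs with
  | nil => simp [firstClash] at h
  | cons r' rs ih =>
    rw [firstClash_cons _ _ _ _ hf] at h
    split_ifs at h with hd
    · exact ⟨List.mem_cons_of_mem _ (ih h).1, (ih h).2⟩
    · obtain rfl := Option.some.inj h
      exact ⟨by simp, hd⟩

theorem eval_sameTrace (hf : ∀ S, f S = (S.biUnion P).card) (e r : X) (rs : List X) :
    eval f I (sameTrace A e r rs) = true ↔ ∀ r' ∈ rs, P r ∩ P r' = P r ∩ P e := by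
  induction rs with
  | nil => simp [sameTrace]
  | cons r' rs ih =>
    rw [sameTrace, List.forall_mem_cons, ← card_sdiff_eq_iff_inter_eq]
    simp only [eval_bind, eval_hold, eval_marginal hf, Finset.biUnion_insert,
      Finset.singleton_biUnion, Nat.cast_inj]
    split_ifs with h
    · rw [ih, and_iff_right h]
    · simp only [eval_pure, Bool.false_eq_true, false_iff]
      exact fun h' => h h'.1

variable [DecidableEq ι]

/-- The common trace on `P p` of the elements of a node with parent element `p`. -/
def trace (P : X → Finset U) (p : X) (sets : List (List X)) : Finset U :=
  P p ∩ sets.flatten.toFinset.biUnion P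

/-- The parent elements of the top nodes, with the traces on them. -/
def Forest.keys (P : X → Finset U) : Forest X → List (X × Finset U)
  | .nil => []
  | .cons p sets _ sib => (p, trace P p sets) :: sib.keys P

/-- The children of a node with elements `S` and trace `Q`. -/
def ForestInv (A : Setup X ι) (I : ι → Finset X → Bool) (P : X → Finset U) (j : ℕ) :
    List X → Finset U → Forest X → Prop
  | _, _, .nil => True
  | S, Q, .cons p sets ch sib =>
    p ∈ S ∧ Q ⊂ trace P p sets ∧ sets.flatten ≠ [] ∧
      NodeInv A I P j (P p) (trace P p sets) sets ∧
      ForestInv A I P j sets.flatten (trace P p sets) ch ∧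
      (p, trace P p sets) ∉ sib.keys P ∧ ForestInv A I P j S Q sib

theorem ForestInv.mono {j : ℕ} {S S' : List X} {Q : Finset U} {F : Forest X}
    (h : ForestInv A I P j S Q F) (hS : ∀ x ∈ S, x ∈ S') : ForestInv A I P j S' Q F := by
  induction F with
  | nil => trivial
  | cons p sets ch sib _ ih =>
    obtain ⟨h1, h2, h3, h4, h5, h6, h7⟩ := h
    exact ⟨hS p h1, h2, h3, h4, h5, h6, ih h7⟩

/-- All stored elements meet P p in the same set, so their union does too. The computed trace of a
nonempty node is thus unaffected by insertions; an empty node would always give ∅. -/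
theorem NodeInv.trace_eq_of_ne_nil {j : ℕ} {p : X} {Q : Finset U} {sets : List (List X)}
    (h : NodeInv A I P j (P p) Q sets) (hne : sets.flatten ≠ []) : trace P p sets = Q := by
  obtain ⟨r, hr⟩ := List.exists_mem_of_ne_nil _ hne
  ext x
  simp only [trace, Finset.mem_inter, Finset.mem_biUnion, List.mem_toFinset]
  constructor
  · rintro ⟨hx, r', hr', hx'⟩
    rw [← h.trace_eq r' hr']
    exact Finset.mem_inter.2 ⟨hx', hx⟩
  · intro hx
    rw [← h.trace_eq r hr, Finset.mem_inter] at hx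
    exact ⟨hx.2, r, hr, hx.1⟩

/-- The effect of the insertion of `e` at a node or below it. -/
structure VisitSpec (A : Setup X ι) (M : ι → Matroid X) (f : Finset X → ℕ) (P : X → Finset U)
    (j : ℕ) (C Q : Finset U) (e : X) (sets : List (List X)) (ch : Forest X)
    (sets' : List (List X)) (ch' : Forest X) : Prop where
  node : NodeInv A (indepOracle M) P j C Q sets'
  forest : ForestInv A (indepOracle M) P j sets'.flatten Q ch'
  subset_sets : ∀ x ∈ sets.flatten, x ∈ sets'.flatten
  sets_subset : ∀ x ∈ sets'.flatten, x = e ∨ x ∈ sets.flatten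
  subset_elems : ch.elems ⊆ ch'.elems
  elems_subset : ch'.elems ⊆ insert e ch.elems
  subst : Substitutable M f A.z e (sets'.flatten.toFinset ∪ ch'.elems)

/-- The effect of the insertion of `e` into the children of a node. -/
structure PlaceSpec (A : Setup X ι) (M : ι → Matroid X) (f : Finset X → ℕ) (P : X → Finset U)
    (j : ℕ) (S : List X) (Q : Finset U) (e r : X) (F F' : Forest X) : Prop where
  forest : ForestInv A (indepOracle M) P j S Q F'
  keys : ∀ k ∈ F'.keys P, k = (r, P e ∩ P r) ∨ k ∈ F.keys P
  subset_elems : F.elems ⊆ F'.elems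
  elems_subset : F'.elems ⊆ insert e F.elems
  subst : Substitutable M f A.z e F'.elems

/-- The strict inclusion is what bounds the depth: `e` and the clashing `r` both contain Q, and they
share a point outside the parent's cover, which Q cannot contain. -/
theorem eval_visit_cases (hf : ∀ S, f S = (S.biUnion P).card) {j : ℕ} {p : Option X}
    {Q : Finset U} {sets : List (List X)} {e : X} (hN : NodeInv A I P j (cover P p) Q sets)
    (he : Reaches P j (cover P p) Q sets e) (ch : Forest X)
    (descend : X → OProg X ι (Forest X)) :
    (eval f I (firstClash A e p sets.flatten) = none ∧
      (∀ r ∈ sets.flatten, Disjoint (P e \ cover P p) (P r)) ∧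
      eval f I (visit A e p sets ch descend) = (insertSets A I e sets, ch)) ∨
    ∃ r ∈ sets.flatten, eval f I (firstClash A e p sets.flatten) = some r ∧ Q ⊂ P e ∩ P r ∧
      eval f I (visit A e p sets ch descend) = (sets, eval f I (descend r)) := by
  rw [visit, eval_bind]
  rcases hc : eval f I (firstClash A e p sets.flatten) with _ | r
  · refine Or.inl ⟨rfl, firstClash_eq_none hf hc, ?_⟩
    simp [eval_processElem f hN.stable]
  · obtain ⟨hr, hd⟩ := firstClash_eq_some hf hc
    refine Or.inr ⟨r, hr, rfl, ?_, by simp⟩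
    obtain ⟨x, hx, hxr⟩ := Finset.not_disjoint_iff.1 hd
    rw [Finset.mem_sdiff] at hx
    rw [Finset.ssubset_iff_subset_ne]
    constructor
    · refine Finset.subset_inter ?_ ?_
      · rw [← he.trace_eq]; exact Finset.inter_subset_left
      · rw [← hN.trace_eq r hr]; exact Finset.inter_subset_left
    · intro heq
      have : x ∈ Q := heq ▸ Finset.mem_inter.2 ⟨hx.1, hxr⟩
      rw [← he.trace_eq] at this
      exact hx.2 (Finset.mem_inter.1 this).2

/-- The invariant of the tree of the elements that cover `j` points. -/
structure TreeInv (A : Setup X ι) (I : ι → Finset X → Bool) (P : X → Finset U) (j : ℕ)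
    (t : Tree X) : Prop where
  node : NodeInv A I P j ∅ ∅ t.sets
  forest : ForestInv A I P j t.sets.flatten ∅ t.children

theorem treeInv_emptyTree (I : ι → Finset X → Bool) (P : X → Finset U) (j : ℕ) :
    TreeInv A I P j (emptyTree A.z) :=
  ⟨nodeInv_replicate _ _ _, trivial⟩

section Insertion

variable [Fintype ι] {M : ι → Matroid X}

/-- The descent is left as a parameter, so that the statement serves the root as well as the inner
nodes within the induction of `placeSpec`. -/
theorem visitSpec (hM : IsMatchoid A.ℓ M) (hg : ∀ e i, i ∈ A.grounds e ↔ e ∈ (M i).E)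
    (hsingle : ∀ e : X, Feasible M {e}) (hf : ∀ S, f S = (S.biUnion P).card) {j : ℕ}
    {p : Option X} {Q : Finset U} {sets : List (List X)} {ch : Forest X} {e : X}
    (hN : NodeInv A (indepOracle M) P j (cover P p) Q sets)
    (he : Reaches P j (cover P p) Q sets e)
    (hch : ForestInv A (indepOracle M) P j sets.flatten Q ch)
    {descend : X → OProg X ι (Forest X)}
    (hdesc : ∀ r ∈ sets.flatten, Q ⊂ P e ∩ P r →
      PlaceSpec A M f P j sets.flatten Q e r ch (eval f (indepOracle M) (descend r))) :
    VisitSpec A M f P j (cover P p) Q e sets ch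
      (eval f (indepOracle M) (visit A e p sets ch descend)).1
      (eval f (indepOracle M) (visit A e p sets ch descend)).2 := by
  rcases eval_visit_cases hf hN he ch descend with ⟨-, hd, heq⟩ | ⟨r, hr, -, hQ, heq⟩ <;> rw [heq]
  · exact
      { node := hN.insertSets he hd
        forest := hch.mono fun x => flatten_subset_insertSets sets
        subset_sets := fun x => flatten_subset_insertSets sets
        sets_subset := fun x => mem_flatten_insertSets
        subset_elems := subset_rfl
        elems_subset := Finset.subset_insert _ _
        subst := (hN.substitutable hM hg hsingle hf he).mono Finset.subset_union_left }
  · have h := hdesc r hr hQ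
    exact
      { node := hN
        forest := h.forest
        subset_sets := fun x => id
        sets_subset := fun x => Or.inr
        subset_elems := h.subset_elems
        elems_subset := h.elems_subset
        subst := h.subst.mono Finset.subset_union_right }

theorem placeSpec (hz : 1 ≤ A.z) (hM : IsMatchoid A.ℓ M)
    (hg : ∀ e i, i ∈ A.grounds e ↔ e ∈ (M i).E)
    (hsingle : ∀ e : X, Feasible M {e}) (hf : ∀ S, f S = (S.biUnion P).card) {j : ℕ} {e : X}
    (hj : (P e).card = j) (F : Forest X) (heF : e ∉ F.elems) (S : List X) (Q : Finset U) (r : X)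
    (hF : ForestInv A (indepOracle M) P j S Q F) (hr : r ∈ S) (hQ : Q ⊂ P e ∩ P r) :
    PlaceSpec A M f P j S Q e r F (eval f (indepOracle M) (place A e r F)) := by
  induction F generalizing S Q r with
  | nil =>
    have hnew : eval f (indepOracle M) (place A e r .nil) =
        .cons r (insertSets A (indepOracle M) e (List.replicate A.z [])) .nil .nil := by
      rw [place]
      simp only [eval_bind, eval_pure]
      rw [eval_processElem f (nodeInv_replicate (P := P) j (P r) Q).stable]
    have hfl := insertSets_replicate_nil (A := A) (I := indepOracle M) (e := e) hz
    have htr : trace P r (insertSets A (indepOracle M) e (List.replicate A.z [])) =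
        P e ∩ P r := by
      rw [trace, hfl]
      simp [Finset.inter_comm]
    rw [hnew]
    refine ⟨⟨hr, htr ▸ hQ, by simp [hfl], ?_, trivial, by simp [Forest.keys], trivial⟩,
      by simp [Forest.keys, htr], by simp [Forest.elems], by simp [Forest.elems, hfl],
      substitutable_of_mem _ _ _ (by simp [Forest.elems, hfl])⟩
    rw [htr]
    exact (nodeInv_replicate j (P r) _).insertSets ⟨by simp, hj, rfl⟩ (by simp)
  | cons p sets ch sib ihc ihs =>
    obtain ⟨hpS, hQp, hne, hN, hch, hk, hsib⟩ := hF
    simp only [Forest.elems, Finset.mem_union, List.mem_toFinset, not_or] at heF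
    by_cases hfit : p = r ∧ ∀ r' ∈ sets.flatten, P r ∩ P r' = P r ∩ P e
    · obtain ⟨rfl, hfit'⟩ := hfit
      have hplace : eval f (indepOracle M) (place A e p (.cons p sets ch sib)) =
          .cons p (eval f (indepOracle M)
            (visit A e (some p) sets ch (fun r' => place A e r' ch))).1
            (eval f (indepOracle M)
              (visit A e (some p) sets ch (fun r' => place A e r' ch))).2 sib := by
        rw [place]
        simp [(eval_sameTrace hf e p _).2 hfit']
      have htr : P e ∩ P p = trace P p sets := by
        obtain ⟨r', hr'⟩ := List.exists_mem_of_ne_nil _ hne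
        rw [← hN.trace_eq r' hr', Finset.inter_comm, ← hfit' r' hr', Finset.inter_comm]
      have hv := visitSpec hM hg hsingle hf (p := some p) (by simpa using hN)
        ⟨heF.1.1, hj, by simpa using htr⟩ hch
        (descend := fun r' => place A e r' ch)
        (fun r' hr' hQ' => ihc heF.1.2 _ _ _ hch hr' hQ')
      rw [hplace]
      generalize eval f (indepOracle M)
        (visit A e (some p) sets ch (fun r' => place A e r' ch)) = v at hv
      obtain ⟨sets', ch'⟩ := v
      rw [cover_some] at hv
      have hne' : sets'.flatten ≠ [] := by
        obtain ⟨r', hr'⟩ := List.exists_mem_of_ne_nil _ hne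
        exact List.ne_nil_of_mem (hv.subset_sets r' hr')
      have htr' : trace P p sets' = trace P p sets := hv.node.trace_eq_of_ne_nil hne'
      refine ⟨⟨hpS, htr' ▸ hQp, hne', htr' ▸ hv.node, htr' ▸ hv.forest, htr' ▸ hk, hsib⟩,
        ?_, ?_, ?_, ?_⟩
      · simp only [Forest.keys, htr']
        exact fun k hk => Or.inr hk
      · simp only [Forest.elems]
        exact Finset.union_subset_union_left (Finset.union_subset_union
          (fun x hx => List.mem_toFinset.2 (hv.subset_sets x (List.mem_toFinset.1 hx)))
          hv.subset_elems)
      · intro x hx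
        simp only [Forest.elems, Finset.mem_union, List.mem_toFinset, Finset.mem_insert] at hx ⊢
        rcases hx with (hx | hx) | hx
        · have := hv.sets_subset x hx; tauto
        · have := Finset.mem_insert.1 (hv.elems_subset hx); tauto
        · tauto
      · simp only [Forest.elems]
        exact hv.subst.mono Finset.subset_union_left
    · have hplace : eval f (indepOracle M) (place A e r (.cons p sets ch sib)) =
          .cons p sets ch (eval f (indepOracle M) (place A e r sib)) := by
        rw [place]
        by_cases hpr : p = r
        · have : eval f (indepOracle M) (sameTrace A e r sets.flatten) = false := by
            rw [Bool.eq_false_iff]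
            exact fun h => hfit ⟨hpr, (eval_sameTrace hf e r _).1 h⟩
          simp [hpr, this]
        · simp [hpr]
      have hs := ihs heF.2 S Q r hsib hr hQ
      rw [hplace]
      refine ⟨⟨hpS, hQp, hne, hN, hch, fun hmem => ?_, hs.forest⟩, ?_, ?_, ?_, ?_⟩
      · rcases hs.keys _ hmem with h | h
        -- If the key of a newly opened child were already present here, `e` would have passed the
        -- trace test at this node.
        · obtain ⟨rfl, h⟩ := Prod.mk.inj h
          refine hfit ⟨rfl, fun r' hr' => ?_⟩
          rw [Finset.inter_comm, hN.trace_eq r' hr', h, Finset.inter_comm]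
        · exact hk h
      · intro k hk
        simp only [Forest.keys, List.mem_cons] at hk ⊢
        rcases hk with hk | hk
        · tauto
        · have := hs.keys k hk; tauto
      · simp only [Forest.elems]
        exact Finset.union_subset_union_right hs.subset_elems
      · intro x hx
        simp only [Forest.elems, Finset.mem_union, Finset.mem_insert] at hx ⊢
        rcases hx with hx | hx
        · tauto
        · have := Finset.mem_insert.1 (hs.elems_subset hx); tauto
      · simp only [Forest.elems]
        exact hs.subst.mono Finset.subset_union_right

theorem Tree.insertElem_spec (hz : 1 ≤ A.z) (hM : IsMatchoid A.ℓ M)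
    (hg : ∀ e i, i ∈ A.grounds e ↔ e ∈ (M i).E)
    (hsingle : ∀ e : X, Feasible M {e}) (hf : ∀ S, f S = (S.biUnion P).card) {j : ℕ} {e : X}
    (hj : (P e).card = j) {t : Tree X} (ht : TreeInv A (indepOracle M) P j t)
    (het : e ∉ t.elems) :
    TreeInv A (indepOracle M) P j (eval f (indepOracle M) (insertElem A e t)) ∧
    t.elems ⊆ (eval f (indepOracle M) (insertElem A e t)).elems ∧
    (eval f (indepOracle M) (insertElem A e t)).elems ⊆ insert e t.elems ∧
    Substitutable M f A.z e (eval f (indepOracle M) (insertElem A e t)).elems := by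
  simp only [Tree.elems, Finset.mem_union, List.mem_toFinset, not_or] at het
  have hv := visitSpec hM hg hsingle hf (p := none) (by simpa using ht.node)
    ⟨het.1, hj, by simp⟩ ht.forest (descend := fun r => place A e r t.children)
    (fun r hr hQ => placeSpec hz hM hg hsingle hf hj _ het.2 _ _ _ ht.forest hr hQ)
  rw [cover_none] at hv
  rw [insertElem, eval_bind, eval_pure]
  refine ⟨⟨hv.node, hv.forest⟩, ?_, ?_, hv.subst⟩
  · exact Finset.union_subset_union
      (fun x hx => List.mem_toFinset.2 (hv.subset_sets x (List.mem_toFinset.1 hx)))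
      hv.subset_elems
  · intro x hx
    simp only [Tree.elems, Finset.mem_union, List.mem_toFinset, Finset.mem_insert] at hx ⊢
    rcases hx with hx | hx
    · have := hv.sets_subset x hx; tauto
    · have := Finset.mem_insert.1 (hv.elems_subset hx); tauto

end Insertion

end Coverage

/-! ### The kernel property: moving a solution into the store, and the main loop. -/

namespace Coverage
open OProg hiding pure bind

/-- A covering set contains a subset with at most `z` elements that covers `z` points. -/
theorem exists_subset_card_le {X U : Type} [DecidableEq X] [DecidableEq U] (P : X → Finset U)
    {O : Finset X} {z : ℕ} (h : z ≤ (O.biUnion P).card) :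
    ∃ S ⊆ O, z ≤ (S.biUnion P).card ∧ S.card ≤ z := by
  obtain ⟨T, hT, hTc⟩ := Finset.exists_subset_card_eq h
  have : ∀ x ∈ T, ∃ o ∈ O, x ∈ P o := fun x hx => Finset.mem_biUnion.1 (hT hx)
  choose g hgO hgP using this
  refine ⟨T.attach.image fun x => g x.1 x.2, Finset.image_subset_iff.2 fun x _ => hgO _ _, ?_,
    Finset.card_image_le.trans (by rw [Finset.card_attach, hTc])⟩
  rw [← hTc]
  exact Finset.card_le_card fun x hx => Finset.mem_biUnion.2
    ⟨g x hx, Finset.mem_image.2 ⟨⟨x, hx⟩, Finset.mem_attach _ _, rfl⟩, hgP x hx⟩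

/-- If every element that covers a point is substitutable by elements of `R`, then `R` is a
kernel. -/
theorem isKernel_of_substitutable {X ι U : Type} [DecidableEq X] [DecidableEq U]
    {M : ι → Matroid X} {P : X → Finset U} {f : Finset X → ℕ}
    (hf : ∀ S, f S = (S.biUnion P).card) {z : ℕ} {R : Finset X}
    (h : ∀ o, f {o} = 0 ∨ Substitutable M f z o R) : IsKernel M f z R := by
  rintro ⟨O, hO, hOz⟩
  rw [hf] at hOz
  obtain ⟨S, hSO, hSz, hSc⟩ := exists_subset_card_le P hOz
  rw [← hf] at hSz
  -- Induction on the number of elements of the solution that are not stored.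
  have key : ∀ (n : ℕ) (S : Finset X), (S \ R).card ≤ n → Feasible M S → z ≤ f S → S.card ≤ z →
      ∃ S ⊆ R, Feasible M S ∧ z ≤ f S ∧ S.card ≤ z := by
    intro n
    induction n with
    | zero =>
      intro S h0 h1 h2 h3
      refine ⟨S, Finset.sdiff_eq_empty_iff_subset.1 ?_, h1, h2, h3⟩
      exact Finset.card_eq_zero.1 (Nat.le_zero.1 h0)
    | succ n ih =>
      intro S h0 h1 h2 h3
      by_cases hSR : S ⊆ R
      · exact ⟨S, hSR, h1, h2, h3⟩
      obtain ⟨o, hoS, hoR⟩ := Finset.not_subset.1 hSR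
      have hlt : (S.erase o \ R).card ≤ n := by
        rw [Finset.erase_sdiff_comm, Finset.card_erase_of_mem (Finset.mem_sdiff.2 ⟨hoS, hoR⟩)]
        omega
      have hc : (S.erase o).card + 1 = S.card := Finset.card_erase_add_one hoS
      -- A superfluous `o` is dropped. Otherwise f (S - o) < z, which is what substitution needs; it
      -- also excludes that `o` covers nothing.
      by_cases hz : z ≤ f (S.erase o)
      · exact ih _ hlt (h1.mono (S.erase_subset o)) hz (by omega)
      rcases h o with h4 | h4
      · refine absurd ?_ hz
        have : f S = f (S.erase o) := by
          conv_lhs => rw [← Finset.insert_erase hoS]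
          rw [hf] at h4
          rw [hf, hf, Finset.biUnion_insert]
          simp only [Finset.singleton_biUnion, Finset.card_eq_zero] at h4
          rw [h4, Finset.empty_union]
        omega
      · obtain ⟨e, heR, hef, hev⟩ := h4 S h1 h3 hoS (by omega)
        refine ih _ ?_ hef (h2.trans hev) ((Finset.card_insert_le _ _).trans (by omega))
        rwa [Finset.insert_sdiff_of_mem _ heR]
  exact key _ S le_rfl (hO.mono hSO) hSz hSc

section Step

variable {X ι : Type} [DecidableEq X] [DecidableEq ι]

/-- The main loop from the point where the value `v` of the new element `e` is known. -/
def streamStep (A : Setup X ι) (e : X) (es : List X) (F : ℕ → Tree X) (v : ℕ) :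
    OProg X ι (Finset X) :=
  if A.z ≤ v then pure {e}
  else if v = 0 then streamFrom A es F
  else do
    let t ← OProg.hold (treesBits A F + A.elemBits + v.size) (insertElem A e (F v))
    streamFrom A es (Function.update F v t)

theorem streamFrom_cons (A : Setup X ι) (e : X) (es : List X) (F : ℕ → Tree X) :
    streamFrom A (e :: es) F =
      OProg.hold (treesBits A F + A.elemBits) (OProg.value {e}) >>= streamStep A e es F := rfl

end Step

variable {X ι U : Type} [DecidableEq X] [DecidableEq ι] [DecidableEq U]

/-- The invariant of the main loop after the arrival of the elements of `past`. -/
structure StreamInv (A : Setup X ι) (M : ι → Matroid X) (f : Finset X → ℕ) (P : X → Finset U)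
    (past : List X) (F : ℕ → Tree X) : Prop where
  tree : ∀ j, TreeInv A (indepOracle M) P j (F j)
  elems_subset : ∀ j, ∀ x ∈ (F j).elems, x ∈ past
  lt : ∀ o ∈ past, f {o} < A.z
  subst : ∀ o ∈ past, f {o} = 0 ∨ Substitutable M f A.z o (F (f {o})).elems

variable {A : Setup X ι} {M : ι → Matroid X} {f : Finset X → ℕ} {P : X → Finset U}
  {past : List X} {F : ℕ → Tree X}

theorem Forest.elems_nil : (Forest.nil : Forest X).elems = ∅ := rfl

theorem streamInv_emptyTree : StreamInv A M f P [] fun _ => emptyTree A.z where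
  tree j := treeInv_emptyTree _ _ _
  elems_subset j x hx := by simp [Tree.elems, emptyTree, Forest.elems_nil] at hx
  lt := by simp
  subst := by simp

theorem StreamInv.discard (h : StreamInv A M f P past F) {e : X} (he : f {e} = 0)
    (hz : f {e} < A.z) : StreamInv A M f P (e :: past) F where
  tree := h.tree
  elems_subset j x hx := List.mem_cons_of_mem _ (h.elems_subset j x hx)
  lt := List.forall_mem_cons.2 ⟨hz, h.lt⟩
  subst := List.forall_mem_cons.2 ⟨Or.inl he, h.subst⟩

variable [Fintype ι]

theorem StreamInv.insert (hM : IsMatchoid A.ℓ M)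
    (hg : ∀ e i, i ∈ A.grounds e ↔ e ∈ (M i).E) (hsingle : ∀ e : X, Feasible M {e})
    (hf : ∀ S, f S = (S.biUnion P).card) (h : StreamInv A M f P past F) {e : X}
    (he : e ∉ past) (hz : f {e} < A.z) :
    StreamInv A M f P (e :: past) (Function.update F (f {e})
      (eval f (indepOracle M) (insertElem A e (F (f {e}))))) := by
  have hPe : (P e).card = f {e} := by rw [hf, Finset.singleton_biUnion]
  obtain ⟨h1, h2, h3, h4⟩ := Tree.insertElem_spec (by omega) hM hg hsingle hf hPe
    (h.tree (f {e})) fun hmem => he (h.elems_subset _ _ hmem)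
  -- The trees only grow, so an element that could be substituted at its arrival can still be
  -- substituted later.
  have hmono : ∀ j, (F j).elems ⊆ (Function.update F (f {e})
      (eval f (indepOracle M) (insertElem A e (F (f {e})))) j).elems := by
    intro j
    by_cases hj : j = f {e}
    · subst hj
      rwa [Function.update_self]
    · rw [Function.update_of_ne hj]
  refine ⟨fun j => ?_, fun j x hx => ?_, List.forall_mem_cons.2 ⟨hz, h.lt⟩,
    List.forall_mem_cons.2 ⟨Or.inr ?_, fun o ho => (h.subst o ho).imp_right fun hs =>
      hs.mono (hmono _)⟩⟩
  · by_cases hj : j = f {e}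
    · subst hj
      rwa [Function.update_self]
    · rw [Function.update_of_ne hj]
      exact h.tree j
  · by_cases hj : j = f {e}
    · subst hj
      rw [Function.update_self] at hx
      rcases Finset.mem_insert.1 (h3 hx) with rfl | hx
      · simp
      · exact List.mem_cons_of_mem _ (h.elems_subset _ x hx)
    · rw [Function.update_of_ne hj] at hx
      exact List.mem_cons_of_mem _ (h.elems_subset _ x hx)
  · rwa [Function.update_self]

theorem eval_streamFrom (hM : IsMatchoid A.ℓ M)
    (hg : ∀ e i, i ∈ A.grounds e ↔ e ∈ (M i).E) (hsingle : ∀ e : X, Feasible M {e})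
    (hf : ∀ S, f S = (S.biUnion P).card) (es : List X) (h : StreamInv A M f P past F)
    (hnd : (es ++ past).Nodup) :
    (∃ e, A.z ≤ f {e} ∧ eval f (indepOracle M) (streamFrom A es F) = {e}) ∨
    ∃ F', StreamInv A M f P (es.reverse ++ past) F' ∧
      eval f (indepOracle M) (streamFrom A es F) =
        (Finset.Icc 1 (A.z - 1)).biUnion fun j => (F' j).elems := by
  induction es generalizing past F with
  | nil => exact Or.inr ⟨F, by simpa using h, by simp [streamFrom]⟩
  | cons e es ih =>
    rw [List.cons_append, List.nodup_cons, List.mem_append, not_or] at hnd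
    have hnd' : (es ++ e :: past).Nodup :=
      List.nodup_middle.2 (List.nodup_cons.2 ⟨by simpa using hnd.1, hnd.2⟩)
    rw [streamFrom_cons, eval_bind, eval_hold, eval_value, List.reverse_cons, List.append_assoc,
      List.singleton_append, streamStep]
    by_cases h1 : A.z ≤ f {e}
    · exact Or.inl ⟨e, h1, by rw [if_pos h1, eval_pure]⟩
    rw [if_neg h1]
    by_cases h2 : f {e} = 0
    · rw [if_pos h2]
      exact ih (h.discard h2 (by omega)) hnd'
    · rw [if_neg h2]
      exact ih (h.insert hM hg hsingle hf hnd.1.2 (by omega)) hnd'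

theorem isKernel_streamingCoverage (hM : IsMatchoid A.ℓ M)
    (hg : ∀ e i, i ∈ A.grounds e ↔ e ∈ (M i).E) (hsingle : ∀ e : X, Feasible M {e})
    (hf : ∀ S, f S = (S.biUnion P).card) {stream : List X} (hnd : stream.Nodup)
    (hall : ∀ e, e ∈ stream) (hz : 1 ≤ A.z) :
    IsKernel M f A.z (eval f (indepOracle M) (streamingCoverage A stream)) := by
  rcases eval_streamFrom hM hg hsingle hf stream (streamInv_emptyTree (A := A) (M := M) (f := f)
    (P := P)) (by simpa using hnd) with ⟨e, he, heq⟩ | ⟨F', hF', heq⟩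
  · rw [streamingCoverage, heq]
    -- After an early stop, the single output element is itself a solution.
    exact fun _ => ⟨{e}, subset_rfl, hsingle e, he, by simpa using hz⟩
  · rw [streamingCoverage, heq]
    refine isKernel_of_substitutable hf fun o => ?_
    have ho : o ∈ stream.reverse ++ [] := by simpa using hall o
    have hlt := hF'.lt o ho
    refine or_iff_not_imp_left.2 fun h0 => ((hF'.subst o ho).resolve_left h0).mono ?_
    exact Finset.subset_biUnion_of_mem (fun j => (F' j).elems)
      (Finset.mem_Icc.2 ⟨by omega, by omega⟩)

end Coverage

/-! ### Number of nodes, stored elements and value queries. -/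

namespace Coverage
open OProg hiding pure bind

/-- A bound on the number of nodes of a tree with `K` elements per node whose elements cover at
most `m` points. -/
def treeBound (K : ℕ) : ℕ → ℕ
  | 0 => 1
  | m + 1 => K * 2 ^ (m + 1) * treeBound K m

theorem treeBound_pos {K : ℕ} (hK : 1 ≤ K) (m : ℕ) : 1 ≤ treeBound K m := by
  induction m with
  | zero => exact le_rfl
  | succ m ih => exact Nat.mul_pos (Nat.mul_pos hK (by positivity)) ih

theorem treeBound_mono {K : ℕ} (hK : 1 ≤ K) : Monotone (treeBound K) :=
  monotone_nat_of_le_succ fun m =>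
    Nat.le_mul_of_pos_left _ (Nat.mul_pos hK (by positivity))

/-- The number of nodes of a forest. -/
def Forest.nodes {X : Type} : Forest X → ℕ
  | .nil => 0
  | .cons _ _ ch sib => 1 + ch.nodes + sib.nodes

section PlaceAt

variable {X ι : Type} [DecidableEq X] [DecidableEq ι]

/-- `place` at a node, from the point where it is known whether the node fits. -/
def placeAt (A : Setup X ι) (e r p : X) (sets : List (List X)) (ch sib : Forest X) (fits : Bool) :
    OProg X ι (Forest X) :=
  if fits then do
    let s ← visit A e (some p) sets ch (fun r' => place A e r' ch)
    pure (.cons p s.1 s.2 sib)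
  else do
    let sib' ← OProg.hold 1 (place A e r sib)
    pure (.cons p sets ch sib')

theorem place_cons (A : Setup X ι) (e r p : X) (sets : List (List X)) (ch sib : Forest X) :
    place A e r (.cons p sets ch sib) =
      if p = r then sameTrace A e r sets.flatten >>= placeAt A e r p sets ch sib
      else pure false >>= placeAt A e r p sets ch sib := rfl

end PlaceAt

section Marginals

variable {X ι : Type} [DecidableEq X] {A : Setup X ι} {f : Finset X → ℕ}
  {I : ι → Finset X → Bool}

theorem valueQueries_marginal (x : X) (S : Finset X) :
    valueQueries f I (marginal x S) = 2 := rfl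

theorem valueQueries_firstClash_le (e : X) (p : Option X) (rs : List X) :
    valueQueries f I (firstClash A e p rs) ≤ 4 * rs.length := by
  induction rs with
  | nil => simp [firstClash]
  | cons r rs ih =>
    rw [firstClash]
    simp only [valueQueries_bind, valueQueries_hold, valueQueries_marginal, List.length_cons]
    split_ifs <;> (try rw [valueQueries_pure]) <;> omega

theorem valueQueries_sameTrace_le (e r : X) (rs : List X) :
    valueQueries f I (sameTrace A e r rs) ≤ 6 * rs.length := by
  induction rs with
  | nil => simp [sameTrace]
  | cons r rs ih =>
    rw [sameTrace]
    simp only [valueQueries_bind, valueQueries_hold, valueQueries_marginal, List.length_cons]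
    split_ifs <;> (try rw [valueQueries_pure]) <;> omega

end Marginals

/-- The maximal size of a set that is stored at a node. -/
def setBound {X ι : Type} (A : Setup X ι) : ℕ := guessBound A.ℓ ((A.z - 1) * A.ℓ)

/-- The maximal number of elements that are stored at a node. -/
def nodeBound {X ι : Type} (A : Setup X ι) : ℕ := A.z * setBound A

/-- A bound on the number of elements stored in all trees. -/
def storeBound {X ι : Type} (A : Setup X ι) : ℕ :=
  A.z * (nodeBound A * treeBound (nodeBound A) (A.z - 1))

theorem guessBound_pos (ℓ d : ℕ) : 1 ≤ guessBound ℓ d := by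
  cases d <;> simp [guessBound]

theorem nodeBound_pos {X ι : Type} {A : Setup X ι} (hz : 1 ≤ A.z) : 1 ≤ nodeBound A :=
  Nat.mul_pos hz (guessBound_pos _ _)

theorem node_mul_treeBound_le_storeBound {X ι : Type} {A : Setup X ι} (hz : 1 ≤ A.z) :
    nodeBound A * treeBound (nodeBound A) (A.z - 1) ≤ storeBound A :=
  Nat.le_mul_of_pos_left _ hz

theorem storeBound_pos {X ι : Type} {A : Setup X ι} (hz : 1 ≤ A.z) : 1 ≤ storeBound A :=
  Nat.mul_pos hz (Nat.mul_pos (nodeBound_pos hz) (treeBound_pos (nodeBound_pos hz) _))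

variable {X ι U : Type} [DecidableEq X] [DecidableEq ι] [DecidableEq U] {A : Setup X ι}
  {I : ι → Finset X → Bool} {P : X → Finset U}

theorem length_flatten_le {α : Type} {c : ℕ} (L : List (List α)) (h : ∀ R ∈ L, R.length ≤ c) :
    L.flatten.length ≤ L.length * c := by
  induction L with
  | nil => simp
  | cons R L ih =>
    rw [List.forall_mem_cons] at h
    rw [List.flatten_cons, List.length_append, List.length_cons, Nat.succ_mul]
    have := ih h.2
    omega

/-- A stable set is contained in its own `repSet`, whose size is bounded. -/
theorem NodeInv.length_le (hA : ∀ e, (A.grounds e).length ≤ A.ℓ) {j : ℕ} {C Q : Finset U}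
    {sets : List (List X)} (h : NodeInv A I P j C Q sets) :
    ∀ R ∈ sets, R.length ≤ setBound A := by
  intro R hR
  rw [← List.toFinset_card_of_nodup ((List.nodup_flatten.1 h.nodup).1 R hR)]
  refine le_trans (Finset.card_le_card fun x hx => ?_)
    (card_guessSet_le A I hA ((A.z - 1) * A.ℓ) [] R)
  exact h.stable R hR x (List.mem_toFinset.1 hx)

theorem NodeInv.length_flatten_le (hA : ∀ e, (A.grounds e).length ≤ A.ℓ) {j : ℕ}
    {C Q : Finset U} {sets : List (List X)} (h : NodeInv A I P j C Q sets) :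
    sets.flatten.length ≤ nodeBound A :=
  (Coverage.length_flatten_le sets (h.length_le hA)).trans_eq (by rw [h.length_eq, nodeBound])

theorem NodeInv.subset {j : ℕ} {C Q : Finset U} {sets : List (List X)}
    (h : NodeInv A I P j C Q sets) : ∀ r ∈ sets.flatten, Q ⊆ P r := fun r hr => by
  rw [← h.trace_eq r hr]; exact Finset.inter_subset_left

section Size

variable {j : ℕ} {S : List X} {Q : Finset U} {F : Forest X}

theorem ForestInv.nodup_keys (h : ForestInv A I P j S Q F) : (F.keys P).Nodup := by
  induction F with
  | nil => exact List.nodup_nil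
  | cons p sets ch sib _ ih => exact List.nodup_cons.2 ⟨h.2.2.2.2.2.1, ih h.2.2.2.2.2.2⟩

theorem ForestInv.mem_keys (h : ForestInv A I P j S Q F) :
    ∀ k ∈ F.keys P, k.1 ∈ S ∧ k.2 ∈ Finset.Ioc Q (P k.1) := by
  induction F with
  | nil => simp [Forest.keys]
  | cons p sets ch sib _ ih =>
    refine List.forall_mem_cons.2 ⟨⟨h.1, Finset.mem_Ioc.2 ⟨h.2.1, ?_⟩⟩, ih h.2.2.2.2.2.2⟩
    exact Finset.inter_subset_left

/-- The keys are distinct pairs (p, Q') with p in `S` and Q ⊂ Q' ⊆ P p. Strictness excludes Q' = Q,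
whence the -1. -/
theorem ForestInv.length_keys_le (h : ForestInv A I P j S Q F)
    (hS : ∀ r ∈ S, (P r).card = j ∧ Q ⊆ P r) :
    (F.keys P).length ≤ S.length * (2 ^ (j - Q.card) - 1) := by
  rw [← List.toFinset_card_of_nodup h.nodup_keys]
  have hsub : (F.keys P).toFinset ⊆ S.toFinset.biUnion fun p =>
      (Finset.Ioc Q (P p)).image (Prod.mk p) := by
    intro k hk
    obtain ⟨h1, h2⟩ := h.mem_keys k (List.mem_toFinset.1 hk)
    exact Finset.mem_biUnion.2 ⟨k.1, List.mem_toFinset.2 h1, Finset.mem_image.2 ⟨k.2, h2, rfl⟩⟩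
  refine (Finset.card_le_card hsub).trans ?_
  refine (Finset.card_biUnion_le_card_mul _ _ (2 ^ (j - Q.card) - 1) fun p hp => ?_).trans
    (Nat.mul_le_mul_right _ (List.toFinset_card_le S))
  obtain ⟨h1, h2⟩ := hS p (List.mem_toFinset.1 hp)
  rw [← h1, ← Finset.card_Ioc_finset h2]
  exact Finset.card_image_le

/-- The node itself is paid for by the -1 in the number of children, which leaves K * treeBound K m
≥ 1 to spare. For j ≤ q there are no children at all. -/
theorem one_add_le_treeBound {K L N q j : ℕ} (hK : 1 ≤ K) (hL : L ≤ K * (2 ^ (j - q) - 1))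
    (hN : ∀ m, j ≤ q + (m + 1) → N ≤ L * treeBound K m) (m : ℕ) (hm : j ≤ q + m) :
    1 + N ≤ treeBound K m := by
  cases m with
  | zero =>
    have h0 : j - q = 0 := by omega
    rw [h0] at hL
    have hL0 : L = 0 := by simpa using hL
    have := hN 0 (by omega)
    rw [hL0, zero_mul] at this
    simp [treeBound]
    omega
  | succ m =>
    have h1 : L ≤ K * (2 ^ (m + 1) - 1) := hL.trans (Nat.mul_le_mul_left _
      (Nat.sub_le_sub_right (Nat.pow_le_pow_right (by norm_num) (by omega)) 1))
    have h2 : K * (2 ^ (m + 1) - 1) + K = K * 2 ^ (m + 1) := by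
      rw [← Nat.mul_succ]
      congr 1
      have : 1 ≤ 2 ^ (m + 1) := Nat.one_le_two_pow
      omega
    rw [treeBound, ← h2, add_mul]
    have h3 := (hN m hm).trans (Nat.mul_le_mul_right (treeBound K m) h1)
    have h4 : 1 ≤ K * treeBound K m := Nat.mul_pos hK (treeBound_pos hK m)
    omega

/-- The parameter `m` bounds the number of points still outside the trace of a child. Each step down
enlarges the trace strictly, so it can be lowered by one. -/
theorem ForestInv.nodes_le (hA : ∀ e, (A.grounds e).length ≤ A.ℓ) (hK : 1 ≤ nodeBound A)
    (h : ForestInv A I P j S Q F) (m : ℕ) (hm : j ≤ Q.card + (m + 1)) :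
    F.nodes ≤ (F.keys P).length * treeBound (nodeBound A) m := by
  induction F generalizing S Q m with
  | nil => simp [Forest.nodes]
  | cons p sets ch sib ihc ihs =>
    obtain ⟨-, hQ, -, hN, hch, -, hsib⟩ := h
    have h1 := ihs hsib m hm
    have hlt := Finset.card_lt_card hQ
    have h2 := one_add_le_treeBound hK ((hch.length_keys_le fun r hr =>
      ⟨hN.card_eq r hr, hN.subset r hr⟩).trans
        (Nat.mul_le_mul_right _ (hN.length_flatten_le hA))) (fun m => ihc hch m) m (by omega)
    rw [Forest.nodes, Forest.keys, List.length_cons, Nat.succ_mul]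
    omega

theorem ForestInv.card_elems_le (hA : ∀ e, (A.grounds e).length ≤ A.ℓ)
    (h : ForestInv A I P j S Q F) : F.elems.card ≤ nodeBound A * F.nodes := by
  induction F generalizing S Q with
  | nil => simp [Forest.elems_nil]
  | cons p sets ch sib ihc ihs =>
    obtain ⟨-, -, -, hN, hch, -, hsib⟩ := h
    have h1 := ihc hch
    have h2 := ihs hsib
    have h3 := (List.toFinset_card_le sets.flatten).trans (hN.length_flatten_le hA)
    rw [Forest.elems, Forest.nodes, mul_add, mul_add, mul_one]
    have h4 := Finset.card_union_le (sets.flatten.toFinset ∪ ch.elems) sib.elems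
    have h5 := Finset.card_union_le sets.flatten.toFinset ch.elems
    omega

theorem TreeInv.nodes_le (hA : ∀ e, (A.grounds e).length ≤ A.ℓ) (hK : 1 ≤ nodeBound A)
    {t : Tree X} (h : TreeInv A I P j t) : 1 + t.children.nodes ≤ treeBound (nodeBound A) j :=
  one_add_le_treeBound hK ((h.forest.length_keys_le fun r hr =>
    ⟨h.node.card_eq r hr, h.node.subset r hr⟩).trans
      (Nat.mul_le_mul_right _ (h.node.length_flatten_le hA)))
    (fun m hm => h.forest.nodes_le hA hK m hm) j (by simp)

theorem TreeInv.card_elems_le (hA : ∀ e, (A.grounds e).length ≤ A.ℓ) (hK : 1 ≤ nodeBound A)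
    {t : Tree X} (h : TreeInv A I P j t) :
    t.elems.card ≤ nodeBound A * treeBound (nodeBound A) j := by
  have h1 := h.forest.card_elems_le hA
  have h2 := (List.toFinset_card_le t.sets.flatten).trans (h.node.length_flatten_le hA)
  have h3 := Nat.mul_le_mul_left (nodeBound A) (h.nodes_le hA hK)
  rw [mul_add, mul_one] at h3
  have h4 := Finset.card_union_le t.sets.flatten.toFinset t.children.elems
  rw [Tree.elems]
  omega

theorem card_streamingCoverage_le [Fintype ι] {M : ι → Matroid X} {f : Finset X → ℕ}
    (hz : 1 ≤ A.z) (hA : ∀ e, (A.grounds e).length ≤ A.ℓ) (hM : IsMatchoid A.ℓ M)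
    (hg : ∀ e i, i ∈ A.grounds e ↔ e ∈ (M i).E) (hsingle : ∀ e : X, Feasible M {e})
    (hf : ∀ S, f S = (S.biUnion P).card) {stream : List X} (hnd : stream.Nodup) :
    (eval f (indepOracle M) (streamingCoverage A stream)).card ≤ storeBound A := by
  rcases eval_streamFrom hM hg hsingle hf stream (streamInv_emptyTree (A := A) (M := M) (f := f)
    (P := P)) (by simpa using hnd) with ⟨e, he, heq⟩ | ⟨F', hF', heq⟩
  · rw [streamingCoverage, heq, Finset.card_singleton]
    exact storeBound_pos hz
  · rw [streamingCoverage, heq]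
    refine (Finset.card_biUnion_le_card_mul _ _ (nodeBound A * treeBound (nodeBound A) (A.z - 1))
      fun i hi => ?_).trans (Nat.mul_le_mul_right _ (by simp))
    refine ((hF'.tree i).card_elems_le hA (nodeBound_pos hz)).trans (Nat.mul_le_mul_left _ ?_)
    exact treeBound_mono (nodeBound_pos hz) (Finset.mem_Icc.1 hi).2

end Size

section Queries

variable {f : Finset X → ℕ}

theorem valueQueries_processElem (e : X) (sets : List (List X)) :
    valueQueries f I (processElem A e sets) = 0 := by
  induction sets with
  | nil => rfl
  | cons R Rs ih =>
    rw [processElem]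
    simp only [valueQueries_bind, valueQueries_hold, repSet, valueQueries_guess]
    split_ifs <;> simp [ih]

theorem valueQueries_visit_le (e : X) (p : Option X) (sets : List (List X)) (ch : Forest X)
    (descend : X → OProg X ι (Forest X)) (n : ℕ)
    (hn : ∀ r, valueQueries f I (descend r) ≤ n) :
    valueQueries f I (visit A e p sets ch descend) ≤ 4 * sets.flatten.length + n := by
  rw [visit, valueQueries_bind]
  refine Nat.add_le_add (valueQueries_firstClash_le e p _) ?_
  rcases eval f I (firstClash A e p sets.flatten) with _ | r
  · simp [valueQueries_processElem]
  · simpa using hn r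

/-- Every node is examined at most once, with at most 6 queries per stored element for `sameTrace`
and 4 for `firstClash`. -/
theorem ForestInv.valueQueries_place_le (hA : ∀ e, (A.grounds e).length ≤ A.ℓ) {j : ℕ}
    {S : List X} {Q : Finset U} {F : Forest X} (h : ForestInv A I P j S Q F) (e r : X) :
    valueQueries f I (place A e r F) ≤ 10 * (nodeBound A * F.nodes) := by
  induction F generalizing S Q r with
  | nil => simp [place, valueQueries_processElem]
  | cons p sets ch sib ihc ihs =>
    obtain ⟨-, -, -, hN, hch, -, hsib⟩ := h
    have hlen := hN.length_flatten_le hA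
    have h1 := (valueQueries_sameTrace_le (f := f) (I := I) (A := A) e r sets.flatten).trans
      (Nat.mul_le_mul_left _ hlen)
    have h2 := valueQueries_visit_le (f := f) (I := I) (A := A) e (some p) sets ch
      (fun r' => place A e r' ch) _ fun r' => ihc hch r'
    have h3 := ihs hsib r
    have h4 : ∀ fits, valueQueries f I (placeAt A e r p sets ch sib fits) ≤
        4 * nodeBound A + 10 * (nodeBound A * ch.nodes) + 10 * (nodeBound A * sib.nodes) := by
      intro fits
      cases fits <;> simp only [placeAt, Bool.false_eq_true, if_true, if_false, valueQueries_bind,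
        valueQueries_pure, valueQueries_hold] <;> omega
    rw [place_cons, Forest.nodes, mul_add (nodeBound A), mul_add (nodeBound A), mul_one]
    split_ifs
    · rw [valueQueries_bind]
      have := h4 (eval f I (sameTrace A e r sets.flatten))
      omega
    · rw [valueQueries_bind, valueQueries_pure, eval_pure]
      have := h4 false
      omega

theorem TreeInv.valueQueries_insertElem_le (hA : ∀ e, (A.grounds e).length ≤ A.ℓ)
    (hK : 1 ≤ nodeBound A) {j : ℕ} {t : Tree X} (h : TreeInv A I P j t) (e : X) :
    valueQueries f I (insertElem A e t) ≤ 10 * (nodeBound A * treeBound (nodeBound A) j) := by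
  have h1 := valueQueries_visit_le (f := f) (I := I) (A := A) e none t.sets t.children
    (fun r' => place A e r' t.children) _ fun r' => h.forest.valueQueries_place_le hA e r'
  have h2 := h.node.length_flatten_le hA
  have h3 := Nat.mul_le_mul_left (nodeBound A) (h.nodes_le hA hK)
  rw [mul_add, mul_one] at h3
  rw [insertElem, valueQueries_bind, valueQueries_pure]
  omega

theorem valueQueries_streamFrom_le [Fintype ι] {M : ι → Matroid X} (hz : 1 ≤ A.z)
    (hA : ∀ e, (A.grounds e).length ≤ A.ℓ) (hM : IsMatchoid A.ℓ M)
    (hg : ∀ e i, i ∈ A.grounds e ↔ e ∈ (M i).E) (hsingle : ∀ e : X, Feasible M {e})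
    (hf : ∀ S, f S = (S.biUnion P).card) (es : List X) {past : List X} {F : ℕ → Tree X}
    (h : StreamInv A M f P past F) (hnd : (es ++ past).Nodup) :
    valueQueries f (indepOracle M) (streamFrom A es F) ≤ es.length * (11 * storeBound A) := by
  induction es generalizing past F with
  | nil => simp [streamFrom]
  | cons e es ih =>
    rw [List.cons_append, List.nodup_cons, List.mem_append, not_or] at hnd
    have hnd' : (es ++ e :: past).Nodup :=
      List.nodup_middle.2 (List.nodup_cons.2 ⟨by simpa using hnd.1, hnd.2⟩)
    have hpos := storeBound_pos hz
    rw [streamFrom_cons, valueQueries_bind, valueQueries_hold, valueQueries_value, eval_hold,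
      eval_value, streamStep, List.length_cons, Nat.succ_mul]
    by_cases h1 : A.z ≤ f {e}
    · rw [if_pos h1, valueQueries_pure]
      omega
    rw [if_neg h1]
    by_cases h2 : f {e} = 0
    · rw [if_pos h2]
      have := ih (h.discard h2 (by omega)) hnd'
      omega
    · rw [if_neg h2, valueQueries_bind, valueQueries_hold, eval_hold]
      have h3 := ih (h.insert hM hg hsingle hf hnd.1.2 (by omega)) hnd'
      have h4 := (h.tree (f {e})).valueQueries_insertElem_le (f := f) hA (nodeBound_pos hz) e
      have h5 : nodeBound A * treeBound (nodeBound A) (f {e}) ≤ storeBound A :=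
        (Nat.mul_le_mul_left _ (treeBound_mono (nodeBound_pos hz) (by omega))).trans
          (node_mul_treeBound_le_storeBound hz)
      -- The eleventh unit pays for the query of f {e}.
      omega

end Queries

end Coverage

/-! ### Memory. -/

namespace Coverage
open OProg hiding pure bind

theorem size_le_self (n : ℕ) : n.size ≤ n := Nat.size_le.2 Nat.lt_two_pow_self

theorem guessBound_mono {ℓ : ℕ} (hℓ : 1 ≤ ℓ) : Monotone (guessBound ℓ) :=
  monotone_nat_of_le_succ fun _ =>
    (Nat.le_mul_of_pos_left _ hℓ).trans (Nat.le_add_left _ _)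

theorem peakBits_ite_le {X ι β : Type} {f : Finset X → ℕ} {I : ι → Finset X → Bool} {c : Prop}
    [Decidable c] {p q : OProg X ι β} {n : ℕ} (hp : peakBits f I p ≤ n)
    (hq : peakBits f I q ≤ n) : peakBits f I (if c then p else q) ≤ n := by
  split_ifs
  exacts [hp, hq]

/-- The comparisons during a search query at most three elements at a time, so the values held in
memory stay linear in `z`. -/
theorem value_le {X U : Type} [DecidableEq U] {P : X → Finset U} {f : Finset X → ℕ} {z : ℕ}
    (hf : ∀ S, f S = (S.biUnion P).card) {S : Finset X}
    (h : ∀ x ∈ S, (P x).card ≤ z) (hS : S.card ≤ 3) : f S ≤ 3 * z := by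
  rw [hf]
  exact (Finset.card_biUnion_le_card_mul _ _ z h).trans (Nat.mul_le_mul_right _ hS)

section Bounds

variable {X ι : Type}

/-- A bound on the memory of the comparisons of marginal values. -/
def compareBits (A : Setup X ι) : ℕ := 2 * A.elemBits + 2 + 5 * A.z

/-- A bound on the memory of `repSet` on the sets of a node. -/
def repBits (A : Setup X ι) : ℕ :=
  ((A.z - 1) * A.ℓ + 1) * ((2 * setBound A + (setBound A + 1) + (A.z - 1) * A.ℓ + 1) * A.elemBits
    + A.indexBits)

/-- A bound on the memory of the work at a single node. -/
def workBits (A : Setup X ι) : ℕ :=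
  compareBits A + ((2 * setBound A + 1) * A.elemBits + A.z + repBits A)

/-- A bound on the memory in which a node is stored. -/
def nodeBits (A : Setup X ι) : ℕ := nodeBound A * (A.elemBits + 1) + A.z + A.elemBits + 2

end Bounds

section Compare

variable {X ι U : Type} [DecidableEq X] [DecidableEq U] {A : Setup X ι}
  {I : ι → Finset X → Bool} {P : X → Finset U} {f : Finset X → ℕ}

theorem peakBits_marginal_le (x : X) (S : Finset X) :
    peakBits f I (marginal x S) ≤ f (insert x S) := by
  simp only [marginal, peakBits_bind, peakBits_value, peakBits_hold, peakBits_pure, eval_value]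
  simpa using size_le_self _

theorem size_natAbs_marginal_le {z : ℕ} (hf : ∀ S, f S = (S.biUnion P).card) {x : X}
    (hx : (P x).card ≤ z) (S : Finset X) : (eval f I (marginal x S)).natAbs.size ≤ z := by
  rw [eval_marginal hf, Int.natAbs_natCast]
  exact (size_le_self _).trans ((Finset.card_le_card Finset.sdiff_subset).trans hx)

theorem peakBits_firstClash_le (hf : ∀ S, f S = (S.biUnion P).card) {e : X} {p : Option X}
    {rs : List X} (he : (P e).card ≤ A.z) (hp : ∀ x ∈ p, (P x).card ≤ A.z)
    (hrs : ∀ r ∈ rs, (P r).card ≤ A.z) :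
    peakBits f I (firstClash A e p rs) ≤ compareBits A := by
  have hp' : ∀ x ∈ p.toFinset, (P x).card ≤ A.z := fun x hx => hp x (Option.mem_toFinset.1 hx)
  have hpc : p.toFinset.card ≤ 1 := by cases p <;> simp
  induction rs with
  | nil => simp [firstClash]
  | cons r rs ih =>
    rw [List.forall_mem_cons] at hrs
    have h0 := ih hrs.2
    have h1 := (peakBits_marginal_le (I := I) e p.toFinset).trans (value_le (z := A.z) hf
      (Finset.forall_mem_insert _ _ _ |>.2 ⟨he, hp'⟩)
      ((Finset.card_insert_le _ _).trans (by omega)))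
    have h2 := (peakBits_marginal_le (I := I) e (insert r p.toFinset)).trans
      (value_le (z := A.z) hf (Finset.forall_mem_insert _ _ _ |>.2
        ⟨he, Finset.forall_mem_insert _ _ _ |>.2 ⟨hrs.1, hp'⟩⟩)
      ((Finset.card_insert_le _ _).trans (by
        have := Finset.card_insert_le r p.toFinset
        omega)))
    have h3 := size_natAbs_marginal_le (I := I) hf he p.toFinset
    rw [firstClash]
    simp only [peakBits_bind, peakBits_hold, eval_hold]
    rw [compareBits] at h0 ⊢
    refine max_le (by omega) (max_le (by omega) ?_)
    exact peakBits_ite_le (Nat.zero_le _) h0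

theorem peakBits_sameTrace_le (hf : ∀ S, f S = (S.biUnion P).card) {e r : X}
    {rs : List X} (he : (P e).card ≤ A.z) (hr : (P r).card ≤ A.z)
    (hrs : ∀ r ∈ rs, (P r).card ≤ A.z) :
    peakBits f I (sameTrace A e r rs) ≤ compareBits A := by
  induction rs with
  | nil => simp [sameTrace]
  | cons r' rs ih =>
    rw [List.forall_mem_cons] at hrs
    have h0 := ih hrs.2
    have hS : ∀ S : Finset X, (∀ x ∈ S, (P x).card ≤ A.z) → S.card ≤ 2 →
        peakBits f I (marginal r S) ≤ 3 * A.z := fun S h1 h2 =>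
      (peakBits_marginal_le (I := I) r S).trans (value_le (z := A.z) hf
        (Finset.forall_mem_insert _ _ _ |>.2 ⟨hr, h1⟩)
        ((Finset.card_insert_le _ _).trans (by omega)))
    have h1 := hS {r'} (by simpa using hrs.1) (by simp)
    have h2 := hS {e} (by simpa using he) (by simp)
    have h3 := hS {r', e} (by simpa using ⟨hrs.1, he⟩) Finset.card_le_two
    have h4 := size_natAbs_marginal_le (I := I) hf hr {r'}
    have h5 := size_natAbs_marginal_le (I := I) hf hr {e}
    rw [sameTrace]
    simp only [peakBits_bind, peakBits_hold, eval_hold]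
    rw [compareBits] at h0 ⊢
    refine max_le (by omega) (max_le (by omega) (max_le (by omega) ?_))
    exact peakBits_ite_le h0 (Nat.zero_le _)

end Compare

variable {X ι U : Type} [DecidableEq X] [DecidableEq ι] [DecidableEq U] {A : Setup X ι}
  {I : ι → Finset X → Bool} {P : X → Finset U} {f : Finset X → ℕ}

theorem peakBits_repSet_le (hℓ : 1 ≤ A.ℓ) (hA : ∀ e, (A.grounds e).length ≤ A.ℓ) {T : List X}
    (hT : T.length ≤ setBound A + 1) : peakBits f I (repSet A T) ≤ repBits A :=
  peakBits_guess_le A f I hA le_rfl (fun _ hd => guessBound_mono hℓ hd) _ _ _ (by simp) hT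

theorem peakBits_processElem_le (hℓ : 1 ≤ A.ℓ) (hA : ∀ e, (A.grounds e).length ≤ A.ℓ) (e : X)
    {sets : List (List X)} (h : ∀ R ∈ sets, R.length ≤ setBound A) :
    peakBits f I (processElem A e sets) ≤ workBits A := by
  induction sets with
  | nil => simp [processElem]
  | cons R Rs ih =>
    rw [List.forall_mem_cons] at h
    have h0 := ih h.2
    have h1 := peakBits_repSet_le (f := f) (I := I) hℓ hA (T := R ++ [e]) (by simpa using h.1)
    have h2 : (repFinset A I (R ++ [e])).card ≤ setBound A := card_guessSet_le A I hA _ _ _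
    have h3 := size_le_self A.z
    have h4 : ∀ m, m ≤ 2 * setBound A + 1 →
        m * A.elemBits ≤ (2 * setBound A + 1) * A.elemBits := fun m => Nat.mul_le_mul_right _
    have h5 := h4 (R.length + 1) (by omega)
    have h6 := h4 (R.length + 1 + (repFinset A I (R ++ [e])).card) (by omega)
    rw [processElem]
    simp only [peakBits_bind, peakBits_hold, eval_hold, eval_repSet, peakBits_pure]
    refine max_le (by rw [workBits]; omega) (max_le (by rw [workBits]; omega) ?_)
    split_ifs
    · exact Nat.zero_le _
    · exact max_le h0 (Nat.zero_le _)

theorem NodeInv.peakBits_visit_le (hℓ : 1 ≤ A.ℓ) (hA : ∀ e, (A.grounds e).length ≤ A.ℓ)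
    (hf : ∀ S, f S = (S.biUnion P).card) {j : ℕ} (hj : j ≤ A.z) {e : X}
    (he : (P e).card ≤ A.z) {p : Option X} (hp : ∀ x ∈ p, (P x).card ≤ A.z) {C Q : Finset U}
    {sets : List (List X)} (h : NodeInv A I P j C Q sets) (ch : Forest X)
    (descend : X → OProg X ι (Forest X)) (n : ℕ)
    (hn : ∀ r, peakBits f I (descend r) ≤ workBits A + n) :
    peakBits f I (visit A e p sets ch descend) ≤ workBits A + (A.elemBits + 1) + n := by
  have h1 := peakBits_firstClash_le (A := A) (I := I) hf he hp (rs := sets.flatten)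
    fun r hr => (h.card_eq r hr).trans_le hj
  have h2 := peakBits_processElem_le (f := f) (I := I) hℓ hA e (h.length_le hA)
  rw [visit, peakBits_bind]
  refine max_le (by rw [workBits]; omega) ?_
  rcases eval f I (firstClash A e p sets.flatten) with _ | r
  · simp only [peakBits_bind, peakBits_pure]
    omega
  · simp only [peakBits_bind, peakBits_pure, peakBits_hold]
    have := hn r
    omega

/-- Going down holds the clashing element and a bit, going sideways a single bit. Each such step is
charged to a node of its own, and the work at a node is counted once because it does not overlap
with other work. -/
theorem ForestInv.peakBits_place_le (hℓ : 1 ≤ A.ℓ) (hA : ∀ e, (A.grounds e).length ≤ A.ℓ)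
    (hf : ∀ S, f S = (S.biUnion P).card) {j : ℕ} (hj : j ≤ A.z) {e : X}
    (he : (P e).card ≤ A.z) {S : List X} {Q : Finset U} {F : Forest X}
    (h : ForestInv A I P j S Q F) (hS : ∀ r ∈ S, (P r).card = j) (r : X) :
    peakBits f I (place A e r F) ≤ workBits A + F.nodes * (A.elemBits + 1) := by
  induction F generalizing S Q r with
  | nil =>
    have := peakBits_processElem_le (f := f) (I := I) hℓ hA e (sets := List.replicate A.z [])
      fun R hR => by rw [List.eq_of_mem_replicate hR]; exact Nat.zero_le _
    simpa [place, Forest.nodes] using this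
  | cons p sets ch sib ihc ihs =>
    obtain ⟨hpS, -, -, hN, hch, -, hsib⟩ := h
    have hp : (P p).card ≤ A.z := (hS p hpS).trans_le hj
    have h2 := hN.peakBits_visit_le hℓ hA hf hj he (p := some p) (by simpa using hp) ch
      (fun r' => place A e r' ch) _ fun r' => ihc hch hN.card_eq r'
    have h3 := ihs hsib hS r
    have h4 : ∀ fits, peakBits f I (placeAt A e r p sets ch sib fits) ≤
        workBits A + (Forest.cons p sets ch sib).nodes * (A.elemBits + 1) := by
      intro fits
      rw [Forest.nodes, add_mul, add_mul, one_mul]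
      cases fits <;> simp only [placeAt, Bool.false_eq_true, if_true, if_false, peakBits_bind,
        peakBits_pure, peakBits_hold] <;> omega
    rw [place_cons]
    split_ifs with hpr
    · rw [peakBits_bind]
      refine max_le ?_ (h4 _)
      have h1 := peakBits_sameTrace_le (A := A) (I := I) hf he (hpr ▸ hp) (rs := sets.flatten)
        fun r' hr' => (hN.card_eq r' hr').trans_le hj
      rw [workBits]
      omega
    · rw [peakBits_bind, peakBits_pure, eval_pure]
      exact max_le (Nat.zero_le _) (h4 _)

theorem TreeInv.peakBits_insertElem_le (hℓ : 1 ≤ A.ℓ) (hz : 1 ≤ A.z)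
    (hA : ∀ e, (A.grounds e).length ≤ A.ℓ)
    (hf : ∀ S, f S = (S.biUnion P).card) {j : ℕ} (hj : j ≤ A.z) {e : X}
    (he : (P e).card ≤ A.z) {t : Tree X} (h : TreeInv A I P j t) :
    peakBits f I (insertElem A e t) ≤
      workBits A + treeBound (nodeBound A) j * (A.elemBits + 1) := by
  have h1 := h.node.peakBits_visit_le hℓ hA hf hj he (p := none) (by simp) t.children
    (fun r => place A e r t.children) _
    fun r => h.forest.peakBits_place_le hℓ hA hf hj he h.node.card_eq r
  have h2 := Nat.mul_le_mul_right (A.elemBits + 1) (h.nodes_le hA (nodeBound_pos hz))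
  rw [add_mul, one_mul] at h2
  rw [insertElem, peakBits_bind, peakBits_pure]
  omega

theorem setsBits_eq {X : Type} (b : ℕ) (sets : List (List X)) :
    setsBits b sets = sets.flatten.length * (b + 1) + sets.length := by
  induction sets with
  | nil => simp [setsBits]
  | cons R Rs ih =>
    rw [setsBits] at ih
    rw [setsBits, List.map_cons, List.sum_cons, ih, List.flatten_cons, List.length_append,
      List.length_cons]
    ring

/-- The surplus pays for the parent element, the bit announcing the node, and one bit ending a list
of siblings; a forest has one such end more than it has nodes. -/
theorem NodeInv.setsBits_le (hA : ∀ e, (A.grounds e).length ≤ A.ℓ) {j : ℕ} {C Q : Finset U}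
    {sets : List (List X)} (h : NodeInv A I P j C Q sets) :
    setsBits A.elemBits sets + A.elemBits + 2 ≤ nodeBits A := by
  rw [setsBits_eq, h.length_eq, nodeBits]
  have := Nat.mul_le_mul_right (A.elemBits + 1) (h.length_flatten_le hA)
  omega

theorem ForestInv.bits_le (hA : ∀ e, (A.grounds e).length ≤ A.ℓ) {j : ℕ} {S : List X}
    {Q : Finset U} {F : Forest X} (h : ForestInv A I P j S Q F) :
    F.bits A.elemBits ≤ F.nodes * nodeBits A + 1 := by
  induction F generalizing S Q with
  | nil => simp [Forest.bits]
  | cons p sets ch sib ihc ihs =>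
    obtain ⟨-, -, -, hN, hch, -, hsib⟩ := h
    have h1 := ihc hch
    have h2 := ihs hsib
    have h3 := hN.setsBits_le hA
    rw [Forest.bits, Forest.nodes, add_mul, add_mul, one_mul]
    omega

theorem TreeInv.bits_le (hA : ∀ e, (A.grounds e).length ≤ A.ℓ) (hz : 1 ≤ A.z) {j : ℕ}
    {t : Tree X} (h : TreeInv A I P j t) :
    t.bits A.elemBits ≤ treeBound (nodeBound A) j * nodeBits A := by
  have h1 := h.forest.bits_le hA
  have h2 := h.node.setsBits_le hA
  have h3 := Nat.mul_le_mul_right (nodeBits A) (h.nodes_le hA (nodeBound_pos hz))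
  rw [add_mul, one_mul] at h3
  rw [Tree.bits]
  omega

theorem StreamInv.treesBits_le (hA : ∀ e, (A.grounds e).length ≤ A.ℓ) (hz : 1 ≤ A.z)
    {M : ι → Matroid X} {past : List X} {F : ℕ → Tree X} (h : StreamInv A M f P past F) :
    treesBits A F ≤ (A.z - 1) * (treeBound (nodeBound A) (A.z - 1) * nodeBits A) := by
  have := Finset.sum_le_card_nsmul (Finset.Icc 1 (A.z - 1)) (fun j => (F j).bits A.elemBits)
    (treeBound (nodeBound A) (A.z - 1) * nodeBits A) fun j hj =>
      ((h.tree j).bits_le hA hz).trans (Nat.mul_le_mul_right _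
        (treeBound_mono (nodeBound_pos hz) (Finset.mem_Icc.1 hj).2))
  simpa [treesBits] using this

/-- An insertion takes place only if 0 < f {e} < z, so its memory has to be covered only for z ≥ 2.
-/
theorem peakBits_streamFrom_le [Fintype ι] {M : ι → Matroid X} (hz : 1 ≤ A.z) (hℓ : 1 ≤ A.ℓ)
    (hA : ∀ e, (A.grounds e).length ≤ A.ℓ) (hM : IsMatchoid A.ℓ M)
    (hg : ∀ e i, i ∈ A.grounds e ↔ e ∈ (M i).E) (hsingle : ∀ e : X, Feasible M {e})
    (hf : ∀ S, f S = (S.biUnion P).card) {N : ℕ}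
    (hN : (A.z - 1) * (treeBound (nodeBound A) (A.z - 1) * nodeBits A) + A.elemBits ≤ N)
    (hN' : 2 ≤ A.z → (A.z - 1) * (treeBound (nodeBound A) (A.z - 1) * nodeBits A) + A.elemBits +
      A.z + (workBits A + treeBound (nodeBound A) (A.z - 1) * (A.elemBits + 1)) ≤ N)
    (es : List X) {past : List X} {F : ℕ → Tree X}
    (h : StreamInv A M f P past F) (hnd : (es ++ past).Nodup) :
    peakBits f (indepOracle M) (streamFrom A es F) ≤ N := by
  induction es generalizing past F with
  | nil =>
    have h0 := h.treesBits_le hA hz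
    simp only [streamFrom, peakBits_hold, peakBits_pure]
    omega
  | cons e es ih =>
    rw [List.cons_append, List.nodup_cons, List.mem_append, not_or] at hnd
    have hnd' : (es ++ e :: past).Nodup :=
      List.nodup_middle.2 (List.nodup_cons.2 ⟨by simpa using hnd.1, hnd.2⟩)
    have h0 := h.treesBits_le hA hz
    rw [streamFrom_cons, peakBits_bind, peakBits_hold, peakBits_value, eval_hold,
      eval_value, streamStep]
    refine max_le (by omega) ?_
    by_cases h1 : A.z ≤ f {e}
    · rw [if_pos h1, peakBits_pure]
      exact Nat.zero_le _
    rw [if_neg h1]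
    by_cases h2 : f {e} = 0
    · rw [if_pos h2]
      exact ih (h.discard h2 (by omega)) hnd'
    · rw [if_neg h2, peakBits_bind, peakBits_hold, eval_hold]
      refine max_le ?_ (ih (h.insert hM hg hsingle hf hnd.1.2 (by omega)) hnd')
      have h4 := (h.tree (f {e})).peakBits_insertElem_le hℓ hz hA hf (by omega) (e := e)
        (by rw [hf, Finset.singleton_biUnion] at h1; omega)
      have h5 : treeBound (nodeBound A) (f {e}) * (A.elemBits + 1) ≤
          treeBound (nodeBound A) (A.z - 1) * (A.elemBits + 1) :=
        Nat.mul_le_mul_right _ (treeBound_mono (nodeBound_pos hz) (by omega))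
      have h6 := size_le_self (f {e})
      have h7 := hN' (by omega)
      omega

end Coverage

/-! ### Arithmetic of the bounds. -/

namespace Coverage

theorem treeBound_eq (K m : ℕ) : treeBound K m = K ^ m * 2 ^ (m + 1).choose 2 := by
  induction m with
  | zero => simp [treeBound]
  | succ m ih =>
    rw [treeBound, ih, Nat.choose_succ_succ (m + 1) 1, Nat.choose_one_right, pow_succ K,
      pow_add 2 (m + 1)]
    ring

theorem choose_two_le_sq (m : ℕ) : (m + 1).choose 2 ≤ m ^ 2 := by
  rw [Nat.choose_two_right, Nat.add_sub_cancel]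
  have : (m + 1) * m ≤ m ^ 2 * 2 := by nlinarith [Nat.le_self_pow (n := 2) (by norm_num) m]
  omega

/-- For ℓ > 1, the extra factor 2^z comes from the constant 2 in `guessBound_lt`. The 2 on the
right, attained for m = 1 and m = 2, is the source of the factor 4 in `storeBound_le`. -/
theorem add_choose_two_le_sq (m : ℕ) : m + 1 + (m + 1).choose 2 ≤ m ^ 2 + 2 := by
  rw [Nat.choose_two_right, Nat.add_sub_cancel]
  have : 2 * (m + 1) + (m + 1) * m ≤ 2 * (m ^ 2 + 2) := by
    rcases m with _ | _ | m
    · norm_num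
    · norm_num
    · nlinarith
  omega

theorem guessBound_one (d : ℕ) : guessBound 1 d = d + 1 := by
  induction d with
  | zero => rfl
  | succ d ih => rw [guessBound, ih]; ring

/-- The +1 on the left makes the induction close: multiplied by ℓ ≥ 2, it absorbs the new summand 1
and itself. -/
theorem guessBound_lt {ℓ : ℕ} (hℓ : 2 ≤ ℓ) (d : ℕ) : guessBound ℓ d + 1 ≤ 2 * ℓ ^ d := by
  induction d with
  | zero => simp [guessBound]
  | succ d ih =>
    rw [guessBound, pow_succ]
    nlinarith [Nat.mul_le_mul_left ℓ ih]

theorem succ_le_guessBound {ℓ : ℕ} (hℓ : 1 ≤ ℓ) (d : ℕ) : d + 1 ≤ guessBound ℓ d := by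
  induction d with
  | zero => simp [guessBound]
  | succ d ih =>
    rw [guessBound]
    have := Nat.le_mul_of_pos_left (guessBound ℓ d) hℓ
    omega

/-- By `treeBound_eq` the left side is z K^z 2^(z choose 2), where K is `z` times the set bound. The
set bound is exactly `z` for ℓ = 1 and at most 2ℓ^((z-1)ℓ) otherwise. -/
theorem storeBound_le {X ι : Type} {A : Setup X ι} (hz : 1 ≤ A.z) (hℓ : 1 ≤ A.ℓ) :
    storeBound A ≤ 4 * kernelBound A.ℓ A.z := by
  rw [storeBound, nodeBound, setBound, kernelBound]
  generalize A.ℓ = ℓ at *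
  generalize A.z = z at *
  obtain ⟨m, rfl⟩ := Nat.exists_eq_add_of_le' hz
  rw [treeBound_eq, Nat.add_sub_cancel, ← mul_assoc ((m + 1) * guessBound ℓ (m * ℓ)),
    ← pow_succ', mul_pow]
  split_ifs with h
  · subst h
    rw [guessBound_one, mul_one]
    calc (m + 1) * ((m + 1) ^ (m + 1) * (m + 1) ^ (m + 1) * 2 ^ (m + 1).choose 2)
        = 2 ^ (m + 1).choose 2 * (m + 1) ^ (2 * (m + 1) + 1) := by ring
      _ ≤ 2 ^ m ^ 2 * (m + 1) ^ (2 * (m + 1) + 1) :=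
        Nat.mul_le_mul_right _ (Nat.pow_le_pow_right (by norm_num) (choose_two_le_sq m))
      _ ≤ _ := Nat.le_mul_of_pos_left _ (by norm_num)
  · have h1 : guessBound ℓ (m * ℓ) ≤ 2 * ℓ ^ (m * ℓ) :=
      (Nat.le_succ _).trans (guessBound_lt (by omega) _)
    have h2 := Nat.pow_le_pow_left h1 (m + 1)
    rw [mul_pow] at h2
    calc (m + 1) * ((m + 1) ^ (m + 1) * guessBound ℓ (m * ℓ) ^ (m + 1) * 2 ^ (m + 1).choose 2)
        ≤ (m + 1) * ((m + 1) ^ (m + 1) * (2 ^ (m + 1) * (ℓ ^ (m * ℓ)) ^ (m + 1)) *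
            2 ^ (m + 1).choose 2) := by gcongr
      _ = 2 ^ (m + 1 + (m + 1).choose 2) * (ℓ ^ ((m + 1) * m * ℓ) * (m + 1) ^ (m + 1 + 1)) := by
        rw [← pow_mul, pow_add 2, pow_succ (m + 1) (m + 1),
          show m * ℓ * (m + 1) = (m + 1) * m * ℓ by ring]
        ring
      _ ≤ 2 ^ (m ^ 2 + 2) * (ℓ ^ ((m + 1) * m * ℓ) * (m + 1) ^ (m + 1 + 1)) :=
        Nat.mul_le_mul_right _ (Nat.pow_le_pow_right (by norm_num) (add_choose_two_le_sq m))
      _ = _ := by rw [pow_add]; ring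

/-- The total memory, if `z ≥ 2` and an index is not much longer than an element. -/
theorem total_bits_le {X ι : Type} {A : Setup X ι} (hz : 2 ≤ A.z) (hℓ : 1 ≤ A.ℓ)
    (hb : 1 ≤ A.elemBits) (hib : A.indexBits ≤ A.elemBits + A.ℓ) :
    (A.z - 1) * (treeBound (nodeBound A) (A.z - 1) * nodeBits A) + A.elemBits +
      A.z + (workBits A + treeBound (nodeBound A) (A.z - 1) * (A.elemBits + 1)) ≤
      30 * (storeBound A * A.elemBits) := by
  have hK1 := nodeBound_pos (A := A) (by omega)
  have hT1 : treeBound (nodeBound A) 1 ≤ treeBound (nodeBound A) (A.z - 1) :=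
    treeBound_mono hK1 (by omega)
  have hTK : nodeBound A ≤ treeBound (nodeBound A) (A.z - 1) := by
    simp only [treeBound] at hT1
    omega
  have hS := succ_le_guessBound hℓ ((A.z - 1) * A.ℓ)
  rw [← setBound] at hS
  have hℓD : A.ℓ ≤ (A.z - 1) * A.ℓ := Nat.le_mul_of_pos_left _ (by omega)
  have hzK : A.z ≤ nodeBound A := Nat.le_mul_of_pos_right _ (by omega)
  have hSK : setBound A ≤ nodeBound A := Nat.le_mul_of_pos_left _ (by omega)
  rw [workBits, compareBits, repBits, nodeBits, storeBound]
  generalize (A.z - 1) * A.ℓ = D at *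
  generalize treeBound (nodeBound A) (A.z - 1) = T at *
  generalize nodeBound A = K at *
  generalize setBound A = S at *
  generalize A.elemBits = b at *
  generalize A.indexBits = ib at *
  generalize A.ℓ = ℓ at *
  generalize A.z = z at *
  have hKb : K ≤ K * b := Nat.le_mul_of_pos_right _ hb
  have hbK : b ≤ K * b := Nat.le_mul_of_pos_left _ hK1
  have hSb : S ≤ S * b := Nat.le_mul_of_pos_right _ hb
  have hbS : b ≤ S * b := Nat.le_mul_of_pos_left _ (by omega)
  have hSbK : S * b ≤ K * b := Nat.mul_le_mul_right _ hSK
  have hKT : K * b ≤ K * T * b := Nat.mul_le_mul_right _ (Nat.le_mul_of_pos_right _ (by omega))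
  have hZ : K * T * b ≤ z * (K * T) * b :=
    Nat.mul_le_mul_right _ (Nat.le_mul_of_pos_left _ (by omega))
  have hnode : K * (b + 1) + z + b + 2 ≤ 6 * (K * b) := by
    rw [mul_add, mul_one]
    omega
  have h1 : (z - 1) * (T * (K * (b + 1) + z + b + 2)) ≤ 6 * (z * (K * T) * b) :=
    calc (z - 1) * (T * (K * (b + 1) + z + b + 2)) ≤ z * (T * (6 * (K * b))) :=
          Nat.mul_le_mul (by omega) (Nat.mul_le_mul_left _ hnode)
      _ = _ := by ring
  have h2 : T * (b + 1) ≤ 2 * (K * T * b) :=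
    calc T * (b + 1) ≤ T * (2 * (K * b)) := Nat.mul_le_mul_left _ (by omega)
      _ = _ := by ring
  have h3 : (2 * S + 1) * b ≤ 3 * (K * b) := by
    rw [add_mul, mul_assoc]
    omega
  have h4 : (2 * S + (S + 1) + D + 1) * b ≤ 5 * (S * b) := by
    rw [← mul_assoc]
    exact Nat.mul_le_mul_right _ (by omega)
  have h5 : (D + 1) * ((2 * S + (S + 1) + D + 1) * b + ib) ≤ 7 * (K * T * b) :=
    calc (D + 1) * ((2 * S + (S + 1) + D + 1) * b + ib) ≤ K * (7 * (T * b)) :=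
          Nat.mul_le_mul (by omega) (by
            have : S * b ≤ T * b := Nat.mul_le_mul_right _ (by omega)
            omega)
      _ = _ := by ring
  -- In units of z K T b, the summands are at most 6, 1, 1, 9, 3, 1, 7 and 2, in the order of the
  -- goal with `compareBits` as one summand.
  omega

theorem clog_le_two_mul_logb {n : ℕ} (hn : 2 ≤ n) :
    (Nat.clog 2 n : ℝ) ≤ 2 * Real.logb 2 n := by
  have h1 : (1 : ℝ) ≤ Real.logb 2 n := by
    rw [Real.le_logb_iff_rpow_le (by norm_num) (by positivity), Real.rpow_one]
    exact_mod_cast hn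
  have h2 := Real.natCeil_logb_natCast 2 n
  have h3 := Nat.ceil_lt_add_one (zero_le_one.trans h1)
  rw [← h2]
  push_cast at h3 ⊢
  linarith

theorem clog_le_clog_add {s n ℓ : ℕ} (h : s ≤ n * ℓ) :
    Nat.clog 2 s ≤ Nat.clog 2 n + ℓ := by
  refine Nat.clog_le_of_le_pow (h.trans ?_)
  rw [pow_add]
  exact Nat.mul_le_mul (Nat.le_pow_clog (by norm_num) n) Nat.lt_two_pow_self.le

theorem length_grounds_le {X ι : Type} [DecidableEq ι] {M : ι → Matroid X} {ℓ : ℕ}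
    (hM : IsMatchoid ℓ M) {grounds : X → List ι} (hnd : ∀ e, (grounds e).Nodup)
    (hg : ∀ e i, i ∈ grounds e ↔ e ∈ (M i).E) (e : X) : (grounds e).length ≤ ℓ := by
  have h := hM e
  have h' : {i | e ∈ (M i).E} = ↑(grounds e).toFinset := by
    ext i
    simp [hg]
  rw [h', Set.encard_coe_eq_coe_finsetCard, List.toFinset_card_of_nodup (hnd e)] at h
  exact_mod_cast h

end Coverage

/-! ### Assembly. -/

theorem theorem4 :
    ∃ C : ℝ, 0 < C ∧
      ∀ (X ι : Type) [Fintype X] [DecidableEq X] [Fintype ι] [DecidableEq ι]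
        (ℓ z : ℕ) (_ : 1 ≤ ℓ) (_ : 1 ≤ z)
        (M : ι → Matroid X) (_ : IsMatchoid ℓ M)
        (_ : ∀ e : X, Feasible M {e})
        (f : Finset X → ℕ) (_ : IsUnweightedCoverage f)
        (grounds : X → List ι) (_ : ∀ e, (grounds e).Nodup)
        (_ : ∀ e i, i ∈ grounds e ↔ e ∈ (M i).E)
        (stream : List X) (_ : stream.Nodup) (_ : ∀ e : X, e ∈ stream)
        (A : Coverage.Setup X ι) (_ : A = Coverage.stdSetup ℓ z grounds)
        (I : ι → Finset X → Bool) (_ : I = Coverage.indepOracle M)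
        (R : Finset X) (_ : R = (Coverage.streamingCoverage A stream).eval f I),
        (∀ (T : List X) (w : X → ℝ), T.Pairwise (fun a b => w b < w a) →
          IsJointRepSet M z T.toFinset w ((Coverage.repSet A T).eval f I)) ∧
        IsKernel M f z R ∧
        (R.card : ℝ) ≤ C * Coverage.kernelBound ℓ z ∧
        (2 ≤ Fintype.card X → Fintype.card ι ≤ Fintype.card X * ℓ →
          ((Coverage.streamingCoverage A stream).peakBits f I : ℝ) ≤
            C * (Coverage.kernelBound ℓ z * Real.logb 2 (Fintype.card X))) ∧
        ((Coverage.streamingCoverage A stream).valueQueries f I : ℝ) ≤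
          C * (Coverage.kernelBound ℓ z * Fintype.card X) := by
  -- The memory bound decides: 30 from `total_bits_le`, 4 from `storeBound_le`, and 2 from rounding
  -- up the logarithm. The size needs only 4, the queries 4 · 11.
  refine ⟨240, by norm_num, ?_⟩
  intro X ι _ _ _ _ ℓ z hℓ hz M hM hsingle f hcov grounds hgnd hg stream hnd hall A hAeq I hI R hR
  obtain ⟨U, _, _, P, hf⟩ := hcov
  have hAz : A.z = z := by rw [hAeq]; rfl
  have hAℓ : A.ℓ = ℓ := by rw [hAeq]; rfl
  have hAg : A.grounds = grounds := by rw [hAeq]; rfl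
  have hAb : A.elemBits = Nat.clog 2 (Fintype.card X) := by rw [hAeq]; rfl
  have hAi : A.indexBits = Nat.clog 2 (Fintype.card ι) := by rw [hAeq]; rfl
  clear hAeq
  subst hAz hAℓ hAg hI hR
  have hA := Coverage.length_grounds_le hM hgnd hg
  have hinv := Coverage.streamInv_emptyTree (A := A) (M := M) (f := f) (P := P)
  have hnd' : (stream ++ []).Nodup := by simpa using hnd
  have hstore : (Coverage.storeBound A : ℝ) ≤ 4 * Coverage.kernelBound A.ℓ A.z := by
    exact_mod_cast Coverage.storeBound_le hz hℓ
  refine ⟨fun T w hw => Coverage.isJointRepSet_repSet hM hg hsingle f hw,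
    Coverage.isKernel_streamingCoverage hM hg hsingle hf hnd hall hz, ?_, ?_, ?_⟩
  · have h1 : ((Coverage.streamingCoverage A stream).eval f (Coverage.indepOracle M)).card ≤
        Coverage.storeBound A :=
      Coverage.card_streamingCoverage_le hz hA hM hg hsingle hf hnd
    have h2 : (((Coverage.streamingCoverage A stream).eval f (Coverage.indepOracle M)).card : ℝ) ≤
        Coverage.storeBound A := by exact_mod_cast h1
    linarith
  · intro hn hs
    have hb : 1 ≤ A.elemBits := by
      rw [hAb]
      exact Nat.clog_pos (by norm_num) hn
    have hib : A.indexBits ≤ A.elemBits + A.ℓ := by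
      rw [hAb, hAi]
      exact Coverage.clog_le_clog_add hs
    have hpos := Coverage.storeBound_pos hz
    have h2 := fun h2 : 2 ≤ A.z => Coverage.total_bits_le h2 hℓ hb hib
    have h1 : (Coverage.streamingCoverage A stream).peakBits f (Coverage.indepOracle M) ≤
        30 * (Coverage.storeBound A * A.elemBits) := by
      refine Coverage.peakBits_streamFrom_le hz hℓ hA hM hg hsingle hf ?_ h2 stream hinv hnd'
      by_cases h : 2 ≤ A.z
      · have := h2 h
        omega
      · rw [show A.z - 1 = 0 by omega, zero_mul, zero_add]
        have := Nat.le_mul_of_pos_left A.elemBits hpos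
        omega
    have h3 : ((Coverage.streamingCoverage A stream).peakBits f (Coverage.indepOracle M) : ℝ) ≤
        30 * (Coverage.storeBound A * A.elemBits) := by exact_mod_cast h1
    have h4 := Coverage.clog_le_two_mul_logb hn
    rw [← hAb] at h4
    have h5 := mul_le_mul hstore h4 (by positivity) (by positivity)
    linarith
  · have h1 := Coverage.valueQueries_streamFrom_le hz hA hM hg hsingle hf stream hinv hnd'
    have hlen : stream.length = Fintype.card X := by
      rw [← List.toFinset_card_of_nodup hnd, ← Finset.card_univ]
      congr 1
      ext e
      simp [hall e]
    rw [hlen] at h1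
    have h2 : ((Coverage.streamingCoverage A stream).valueQueries f (Coverage.indepOracle M) : ℝ) ≤
        Fintype.card X * (11 * Coverage.storeBound A) := by exact_mod_cast h1
    have h3 := mul_le_mul_of_nonneg_left hstore (Nat.cast_nonneg (α := ℝ) (Fintype.card X))
    have h4 : (0 : ℝ) ≤ Coverage.kernelBound A.ℓ A.z * Fintype.card X := by positivity
    linarith
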